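/- Conventions. A machine is a partial computable function $M$ on finite binary strings, and $K_M(u)=\min\{|p| : M(p)=u\}$ is the plain Kolmogorov complexity of the string $u$ with respect to $M$. Fix a universal machine $U$, that is, a machine such that for every machine $M$ there is a constant $c$ with $K_U(u)\le K_M(u)+c$ for all strings $u$, and write $K=K_U$. For an infinite binary sequence $x$ let $x(1:n)$ be its initial segment of length $n$. The sequence $x$ has randomness rate $\sigma$ if $K(x(1:n))\ge \sigma n$ for all but finitely many $n$. Two infinite binary sequences $x,y$ are independent if for all natural numbers $n,m$ $$K(x(1:n)\,y(1:m))\ \ge\ K(x(1:n))+K(y(1:m))-O(\log n+\log m),$$ where the constant hidden in $O(\cdot)$ may depend on $x$ and $y$, and $O(\cdot)$ leaves room for an additive constant. A function $f:\mathbb{Q}\times\{0,1\}^\infty\times\{0,1\}^\infty\to\{0,1\}^\infty$ is an effective transformation if there is a two-oracle machine $M_f$ which, for all $\tau\in\mathbb{Q}$, all sequences $x,y$ and all $n$, on input $(\tau,1^n)$ and with oracles $x$ and $y$ halts and outputs the $n$-th bit of $f(\tau,x,y)$; it is a truth-table reduction if $M_f$ halts on all inputs $(\tau,1^n)$ and with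 all oracles. Theorem. There exists an effective transformation $f:\mathbb{Q}\times\{0,1\}^\infty\times\{0,1\}^\infty\to\{0,1\}^\infty$, which is moreover a truth-table reduction, with the following property: for every rational $\tau\in(0,1]$ and all independent sequences $x$ and $y$ with randomness rate $\tau$, the sequence $f(\tau,x,y)$ has randomness rate $1-\delta$ for every $\delta>0$. -/

import Mathlib

namespace RandExt

/-! ### Strings, sequences and plain Kolmogorov complexity -/

/-- Finite binary strings. -/
abbrev Str := List Bool

/-- Infinite binary sequences; the bit with index `k` (from `0` on) is the `(k+1)`-st bit. -/
abbrev BinSeq := ℕ → Bool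

/-- The initial segment of length `n` of an infinite sequence. -/
def BinSeq.initSeg (x : BinSeq) (n : ℕ) : Str := List.ofFn fun i : Fin n => x i

/-- Plain Kolmogorov complexity of `x` with respect to the machine `M` (a partial function on
strings): the least length of a program `p` with `M(p) = x`, and `⊤` if there is none. -/
noncomputable def complexity (M : Str →. Str) (x : Str) : ℕ∞ :=
  ⨅ p : {p : Str // x ∈ M p}, ((p : Str).length : ℕ∞)

/-- A universal machine: a partial computable function on strings whose complexity is, up to an
additive constant, at most that of every other partial computable function. -/
structure IsUniversal (U : Str →. Str) : Prop where
  partrec : Partrec U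
  optimal : ∀ M : Str →. Str, Partrec M →
    ∃ c : ℕ, ∀ x : Str, complexity U x ≤ complexity M x + c

/-- Plain Kolmogorov complexity as a natural number. For a universal machine the complexity is
never `⊤` (see `IsUniversal.complexity_ne_top`), so that nothing is lost. -/
noncomputable def K (U : Str →. Str) (x : Str) : ℕ := (complexity U x).toNat

theorem complexity_le {M : Str →. Str} {p x : Str} (h : x ∈ M p) :
    complexity M x ≤ p.length :=
  iInf_le (fun p : {p : Str // x ∈ M p} => ((p : Str).length : ℕ∞)) ⟨p, h⟩

theorem IsUniversal.complexity_ne_top {U : Str →. Str} (hU : IsUniversal U) (x : Str) :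
    complexity U x ≠ ⊤ := by
  obtain ⟨c, hc⟩ := hU.optimal (fun p => Part.some p) Computable.id
  have h1 : complexity (fun p : Str => Part.some p) x ≤ x.length :=
    complexity_le (Part.mem_some x)
  refine ne_top_of_le_ne_top ?_ ((hc x).trans (add_le_add_left h1 _))
  exact_mod_cast ENat.natCast_ne_top (x.length + c)

/-- Universal machines exist: on input `1^e 0 q`, run the `e`-th program on `q`. -/
theorem exists_isUniversal : ∃ U : Str →. Str, IsUniversal U := by
  let U : Str →. Str := fun p =>
    ((Denumerable.ofNat Nat.Partrec.Code (p.idxOf false)).eval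
      (Encodable.encode (p.drop (p.idxOf false + 1)))).bind
      fun r => ((Encodable.decode r : Option Str) : Part Str)
  have hidx : Primrec fun p : Str => p.idxOf false :=
    Primrec.list_idxOf.comp (Primrec.const false) Primrec.id
  refine ⟨U, ?_, ?_⟩
  · refine Partrec.bind (Nat.Partrec.Code.eval_part.comp
      ((Computable.ofNat _).comp hidx.to_comp) ?_) ?_
    · exact (Primrec.encode.comp
        (Primrec.list_drop.comp (Primrec.succ.comp hidx) Primrec.id)).to_comp
    · exact (Computable.ofOption (Primrec.decode.to_comp.comp Computable.snd))
  · intro M hM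
    obtain ⟨e, he⟩ := Nat.Partrec.Code.exists_code.1 hM
    have hkey : ∀ p x : Str, x ∈ M p →
        x ∈ U (List.replicate (Encodable.encode e) true ++ false :: p) := by
      intro p x hx
      have h1 : (List.replicate (Encodable.encode e) true ++ false :: p).idxOf false
          = Encodable.encode e := by
        rw [List.idxOf_append_of_notMem (by simp [List.mem_replicate])]
        simp
      have h2 : (List.replicate (Encodable.encode e) true ++ false :: p).drop
          (Encodable.encode e + 1) = p := by
        rw [List.drop_append]
        simp
      simp only [U, h1, h2, Denumerable.ofNat_encode, he]
      simpa using hx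
    refine ⟨Encodable.encode e + 1, fun x => ?_⟩
    by_cases hx : Nonempty {p : Str // x ∈ M p}
    · rw [complexity, complexity, ENat.iInf_add]
      refine le_iInf fun p => (complexity_le (hkey p x p.2)).trans (le_of_eq ?_)
      push_cast [List.length_append, List.length_replicate, List.length_cons]
      ring
    · have : IsEmpty {p : Str // x ∈ M p} := not_nonempty_iff.1 hx
      rw [show complexity M x = ⊤ from iInf_of_empty _, top_add]
      exact le_top

/-- `x` has randomness rate `σ`: `K(x(1:n)) ≥ σ n` for all but finitely many `n`. -/
def HasRandomnessRate (U : Str →. Str) (σ : ℝ) (x : BinSeq) : Prop :=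
  ∀ᶠ n : ℕ in Filter.atTop, σ * n ≤ K U (x.initSeg n)

/-- `x` and `y` are independent:
`K(x(1:n) y(1:m)) ≥ K(x(1:n)) + K(y(1:m)) - O(log n + log m)` for all `n` and `m`. As usual the
`O` leaves room for an additive constant (the logarithms vanish at `1`). -/
def Independent (U : Str →. Str) (x y : BinSeq) : Prop :=
  ∃ c : ℝ, ∀ n m : ℕ,
    (K U (x.initSeg n) : ℝ) + K U (y.initSeg m) - c * (Real.logb 2 n + Real.logb 2 m + 1)
      ≤ K U (x.initSeg n ++ y.initSeg m)

/-! ### Machines with two oracles -/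

/-- Programs of machines with two oracles: the partial recursive functions on `ℕ` together with
the two instructions that query the first and the second oracle. -/
inductive OracleMachine : Type
  | zero : OracleMachine
  | succ : OracleMachine
  | left : OracleMachine
  | right : OracleMachine
  | oracle₁ : OracleMachine
  | oracle₂ : OracleMachine
  | pair : OracleMachine → OracleMachine → OracleMachine
  | comp : OracleMachine → OracleMachine → OracleMachine
  | prec : OracleMachine → OracleMachine → OracleMachine
  | rfind : OracleMachine → OracleMachine

/-- The answer of an oracle to the query for its bit with index `k`. -/
def BinSeq.answer (x : BinSeq) (k : ℕ) : ℕ := (x k).toNat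

namespace OracleMachine

/-- The partial function computed by a program that works with the oracles `x` and `y`; it is
undefined at an input on which the computation does not halt. -/
def eval (x y : BinSeq) : OracleMachine → ℕ →. ℕ
  | zero => fun _ => Part.some 0
  | succ => fun n => Part.some (n + 1)
  | left => fun n => Part.some n.unpair.1
  | right => fun n => Part.some n.unpair.2
  | oracle₁ => fun n => Part.some (x.answer n)
  | oracle₂ => fun n => Part.some (y.answer n)
  | pair f g => fun n => Nat.pair <$> eval x y f n <*> eval x y g n
  | comp f g => fun n => eval x y g n >>= eval x y f
  | prec f g => fun p =>
      let (a, n) := Nat.unpair p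
      n.rec (eval x y f a) fun k IH => do
        let i ← IH
        eval x y g (Nat.pair a (Nat.pair k i))
  | rfind f => fun a =>
      Nat.rfind fun n => (fun m => m = 0) <$> eval x y f (Nat.pair a n)

/-- Adequacy: for fixed oracles, the functions computed by the programs are exactly those that
are recursive in the two oracles in the sense of Mathlib. -/
theorem exists_eval_eq_iff (x y : BinSeq) (g : ℕ →. ℕ) :
    (∃ M : OracleMachine, M.eval x y = g) ↔
      Nat.RecursiveIn {(x.answer : ℕ →. ℕ), (y.answer : ℕ →. ℕ)} g := by
  constructor
  · rintro ⟨M, rfl⟩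
    induction M with
    | zero => exact .zero
    | succ => exact .succ
    | left => exact .left
    | right => exact .right
    | oracle₁ => exact .oracle _ (Or.inl rfl)
    | oracle₂ => exact .oracle _ (Or.inr rfl)
    | pair _ _ hf hg => exact .pair hf hg
    | comp _ _ hf hg => exact .comp hf hg
    | prec _ _ hf hg => exact .prec hf hg
    | rfind _ hf => exact .rfind hf
  · intro h
    induction h with
    | zero => exact ⟨.zero, rfl⟩
    | succ => exact ⟨.succ, rfl⟩
    | left => exact ⟨.left, rfl⟩
    | right => exact ⟨.right, rfl⟩
    | oracle g hg =>
      rcases hg with rfl | rfl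
      · exact ⟨.oracle₁, rfl⟩
      · exact ⟨.oracle₂, rfl⟩
    | pair _ _ hf hg =>
      obtain ⟨M, rfl⟩ := hf
      obtain ⟨N, rfl⟩ := hg
      exact ⟨.pair M N, rfl⟩
    | comp _ _ hf hg =>
      obtain ⟨M, rfl⟩ := hf
      obtain ⟨N, rfl⟩ := hg
      exact ⟨.comp M N, rfl⟩
    | prec _ _ hf hg =>
      obtain ⟨M, rfl⟩ := hf
      obtain ⟨N, rfl⟩ := hg
      exact ⟨.prec M N, rfl⟩
    | rfind _ hf =>
      obtain ⟨M, rfl⟩ := hf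
      exact ⟨.rfind M, rfl⟩

/-- The input `(τ, 1^n)` as a number: `τ` is given by its reduced numerator and denominator. -/
def input (τ : ℚ) (n : ℕ) : ℕ :=
  Nat.pair (Nat.pair (Equiv.intEquivNat τ.num) τ.den) n

/-- `f(τ, x, y) = z` for the transformation represented by the machine `M`: for every `n`, on
input `(τ, 1^n)` and with oracles `x` and `y`, the machine halts and outputs the bit `z n`. -/
def Yields (M : OracleMachine) (τ : ℚ) (x y z : BinSeq) : Prop :=
  ∀ n : ℕ, (z n).toNat ∈ M.eval x y (input τ n)

/-- The machine `M` represents the transformation `f`. -/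
def Represents (M : OracleMachine) (f : ℚ → BinSeq → BinSeq → BinSeq) : Prop :=
  ∀ (τ : ℚ) (x y : BinSeq), M.Yields τ x y (f τ x y)

/-- The machine halts on all inputs `(τ, 1^n)` and with all oracles. -/
def IsTruthTable (M : OracleMachine) : Prop :=
  ∀ (τ : ℚ) (n : ℕ) (x y : BinSeq), (M.eval x y (input τ n)).Dom

end OracleMachine

end RandExt

-- The output z is cut into blocks, the j-th with `outLen j` (about 4j^3) bits. Block j is computed
-- from the initial segments u, v of x, y of length n_{j+1}, where n_j = `srcLen Q j` grows
-- geometrically in j. It is the colour of the cell (u, v) of a table in which no colour takes much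
-- more than its fair share of any large rectangle. A random table is of this kind
-- (`exists_balanced`), so the least one can be found by exhaustive search.
--
-- The heart is `IsUniversal.exists_K_extract_succ`: a new block adds `outLen j` - O(j) to the
-- complexity. Let w be the first j blocks, k the complexity of the first j + 1 blocks, and d =
-- `outLen j` - D(j + 1) for a large constant D. If w has at least 2^d one-block extensions of
-- complexity at most k, then w lies in an enumerable set of fewer than 2^(k+1-d) strings, so K(w) ≤
-- k - d + O(j) (`IsUniversal.exists_K_le_of_le_stageDeg`). Otherwise, fixing the prefixes of u and
-- v of length n_j fixes w and confines the next block to fewer than 2^d colours. Balance bounds the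
-- number of pairs (u, v) over each such pair of prefixes. Summation leaves, up to a constant
-- factor, 2^(d + K(u) + K(v) - `outLen j`) candidates (`card_le_of_block_mem`,
-- `IsUniversal.card_suspect_lt`). Hence K(uv) ≤ K(u) + K(v) - D(j + 1) + O(j)
-- (`IsUniversal.exists_K_append_le`). As log n_{j+1} is O(j), this contradicts independence once D
-- is large.
--
-- The sum over prefixes adds 2^(4 n_j) to each side of the rectangle. This is harmless when K(u),
-- K(v) ≥ 4 n_j, which the randomness rate provides if the ratio n_{j+1} / n_j is large compared
-- with 1/τ. Adding up the blocks gives K(z(1:j^4)) ≥ j^4 - O(j^2), and lengths between two fourth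
-- powers cost only O(j^3) more.

attribute [fun_prop] Computable

namespace RandExt

/-! ### Closure properties of computable functions -/

section Closure

variable {α β γ : Type*} [Primcodable α] [Primcodable β] [Primcodable γ]

@[fun_prop] theorem computable_id : Computable fun a : α => a := Computable.id

@[fun_prop] theorem computable_const (b : β) : Computable fun _ : α => b := Computable.const b

@[fun_prop] theorem computable_comp {f : β → γ} {g : α → β} (hf : Computable f)
    (hg : Computable g) : Computable fun a => f (g a) := hf.comp hg

@[fun_prop] theorem computable_prodMk {f : α → β} {g : α → γ} (hf : Computable f)
    (hg : Computable g) : Computable fun a => (f a, g a) := hf.pair hg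

@[fun_prop] theorem computable_fst {f : α → β × γ} (hf : Computable f) :
    Computable fun a => (f a).1 := Computable.fst.comp hf

@[fun_prop] theorem computable_snd {f : α → β × γ} (hf : Computable f) :
    Computable fun a => (f a).2 := Computable.snd.comp hf

@[fun_prop] theorem computable_add {f g : α → ℕ} (hf : Computable f) (hg : Computable g) :
    Computable fun a => f a + g a := Primrec.nat_add.to_comp.comp hf hg

@[fun_prop] theorem computable_sub {f g : α → ℕ} (hf : Computable f) (hg : Computable g) :
    Computable fun a => f a - g a := Primrec.nat_sub.to_comp.comp hf hg

@[fun_prop] theorem computable_mul {f g : α → ℕ} (hf : Computable f) (hg : Computable g) :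
    Computable fun a => f a * g a := Primrec.nat_mul.to_comp.comp hf hg

@[fun_prop] theorem computable_div {f g : α → ℕ} (hf : Computable f) (hg : Computable g) :
    Computable fun a => f a / g a := Primrec.nat_div.to_comp.comp hf hg

@[fun_prop] theorem computable_mod {f g : α → ℕ} (hf : Computable f) (hg : Computable g) :
    Computable fun a => f a % g a := Primrec.nat_mod.to_comp.comp hf hg

@[fun_prop] theorem computable_pow {f g : α → ℕ} (hf : Computable f) (hg : Computable g) :
    Computable fun a => f a ^ g a :=
  (Primrec₂.unpaired'.1 Nat.Primrec.pow).to_comp.comp hf hg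

@[fun_prop] theorem computable_sqrt {f : α → ℕ} (hf : Computable f) :
    Computable fun a => Nat.sqrt (f a) := Primrec.nat_sqrt.to_comp.comp hf

@[fun_prop] theorem computable_natPair {f g : α → ℕ} (hf : Computable f) (hg : Computable g) :
    Computable fun a => Nat.pair (f a) (g a) := Primrec₂.natPair.to_comp.comp hf hg

@[fun_prop] theorem computable_unpair {f : α → ℕ} (hf : Computable f) :
    Computable fun a => Nat.unpair (f a) := Computable.unpair.comp hf

/-- The Boolean test of `a < b`. -/
def ltTest (a b : ℕ) : Bool := decide (a < b)

@[simp] theorem ltTest_eq_true {a b : ℕ} : ltTest a b = true ↔ a < b := decide_eq_true_iff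

@[fun_prop] theorem computable_ltTest {f g : α → ℕ} (hf : Computable f) (hg : Computable g) :
    Computable fun a => ltTest (f a) (g a) := Primrec.nat_lt.decide.to_comp.comp hf hg

/-- The Boolean test of `a ≤ b`. -/
def leTest (a b : ℕ) : Bool := decide (a ≤ b)

@[simp] theorem leTest_eq_true {a b : ℕ} : leTest a b = true ↔ a ≤ b := decide_eq_true_iff

@[fun_prop] theorem computable_leTest {f g : α → ℕ} (hf : Computable f) (hg : Computable g) :
    Computable fun a => leTest (f a) (g a) := Primrec.nat_le.decide.to_comp.comp hf hg

@[fun_prop] theorem computable_decide_eq [DecidableEq β] {f g : α → β} (hf : Computable f)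
    (hg : Computable g) : Computable fun a => decide (f a = g a) :=
  Primrec.eq.decide.to_comp.comp hf hg

@[fun_prop] theorem computable_and {f g : α → Bool} (hf : Computable f) (hg : Computable g) :
    Computable fun a => f a && g a := Primrec.and.to_comp.comp hf hg

@[fun_prop] theorem computable_not {f : α → Bool} (hf : Computable f) :
    Computable fun a => !(f a) := Primrec.not.to_comp.comp hf

@[fun_prop] theorem computable_toNat {f : α → Bool} (hf : Computable f) :
    Computable fun a => (f a).toNat := (Primrec.dom_bool Bool.toNat).to_comp.comp hf

@[fun_prop] theorem computable_encode {f : α → β} (hf : Computable f) :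
    Computable fun a => Encodable.encode (f a) := Computable.encode.comp hf

@[fun_prop] theorem computable_some {f : α → β} (hf : Computable f) :
    Computable fun a => some (f a) := Computable.option_some.comp hf

@[fun_prop] theorem computable_natRec {f : α → ℕ} {g : α → β} {h : α → ℕ → β → β}
    (hf : Computable f) (hg : Computable g)
    (hh : Computable fun p : α × ℕ × β => h p.1 p.2.1 p.2.2) :
    Computable fun a => Nat.rec (motive := fun _ => β) (g a) (h a) (f a) :=
  Computable.nat_rec (h := fun a p => h a p.1 p.2) hf hg hh

-- Bounded sums also yield bounded quantifiers, by counting counterexamples; these make the balance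
-- of a table and the search for programs computable.
@[fun_prop] theorem computable_sum {f : α → ℕ} {g : α → ℕ → ℕ} (hf : Computable f)
    (hg : Computable fun p : α × ℕ => g p.1 p.2) :
    Computable fun a => ∑ i ∈ Finset.range (f a), g a i := by
  have : Computable fun a => Nat.rec (motive := fun _ => ℕ) 0 (fun i s => s + g a i) (f a) := by
    fun_prop
  refine this.of_eq fun a => ?_
  induction f a with
  | zero => simp
  | succ n ih => rw [Finset.sum_range_succ, ← ih]

/-- All numbers below `n` satisfy `p`. -/
def allBelow (n : ℕ) (p : ℕ → Bool) : Bool := decide (∑ i ∈ Finset.range n, (!(p i)).toNat = 0)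

theorem allBelow_eq_true {n : ℕ} {p : ℕ → Bool} : allBelow n p = true ↔ ∀ i < n, p i = true := by
  simp [allBelow]

@[fun_prop] theorem computable_allBelow {f : α → ℕ} {p : α → ℕ → Bool} (hf : Computable f)
    (hp : Computable fun q : α × ℕ => p q.1 q.2) :
    Computable fun a => allBelow (f a) (p a) := by
  unfold allBelow; fun_prop

/-- Some number below `n` satisfies `p`. -/
def anyBelow (n : ℕ) (p : ℕ → Bool) : Bool := !(allBelow n fun i => !(p i))

theorem anyBelow_eq_true {n : ℕ} {p : ℕ → Bool} : anyBelow n p = true ↔ ∃ i < n, p i = true := by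
  rw [anyBelow, Bool.not_eq_true', ← Bool.not_eq_true, allBelow_eq_true]
  simp

@[fun_prop] theorem computable_anyBelow {f : α → ℕ} {p : α → ℕ → Bool} (hf : Computable f)
    (hp : Computable fun q : α × ℕ => p q.1 q.2) :
    Computable fun a => anyBelow (f a) (p a) := by
  unfold anyBelow; fun_prop

theorem partrec_rfind {p : α → ℕ → Bool} (hp : Computable fun q : α × ℕ => p q.1 q.2) :
    Partrec fun a => Nat.rfind (p a : ℕ →. Bool) :=
  Partrec.rfind (p := fun a => (p a : ℕ →. Bool)) hp

theorem computable_find {p : α → ℕ → Bool} (hp : Computable fun q : α × ℕ => p q.1 q.2)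
    (h : ∀ a, ∃ n, p a n = true) : Computable fun a => Nat.find (h a) := by
  refine (partrec_rfind hp).of_eq_tot fun a => ?_
  refine Nat.mem_rfind.2 ⟨?_, fun {m} hm => ?_⟩
  · simpa using (Nat.find_spec (h a))
  · simpa using (Nat.find_min (h a) hm)

@[fun_prop] theorem computable_list_length {f : α → List β} (hf : Computable f) :
    Computable fun a => (f a).length := Computable.list_length.comp hf

@[fun_prop] theorem computable_list_append {f g : α → List β} (hf : Computable f)
    (hg : Computable g) : Computable fun a => f a ++ g a := Computable.list_append.comp hf hg

@[fun_prop] theorem computable_list_getD {f : α → List β} {g : α → ℕ} (d : β)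
    (hf : Computable f) (hg : Computable g) : Computable fun a => (f a).getD (g a) d :=
  (Primrec.list_getD d).to_comp.comp hf hg

@[fun_prop] theorem computable_list_drop {f : α → List β} {g : α → ℕ}
    (hf : Computable f) (hg : Computable g) : Computable fun a => (f a).drop (g a) :=
  Primrec.list_drop.to_comp.comp hg hf

@[fun_prop] theorem computable_list_take {f : α → List β} {g : α → ℕ}
    (hf : Computable f) (hg : Computable g) : Computable fun a => (f a).take (g a) :=
  Primrec.list_take.to_comp.comp hg hf

@[fun_prop] theorem computable_list_idxOf [DecidableEq β] {f : α → List β} {g : α → β}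
    (hf : Computable f) (hg : Computable g) : Computable fun a => (f a).idxOf (g a) :=
  Primrec.list_idxOf.to_comp.comp hg hf

@[fun_prop] theorem computable_list_map_range {f : α → ℕ} {g : α → ℕ → β} (hf : Computable f)
    (hg : Computable fun p : α × ℕ => g p.1 p.2) :
    Computable fun a => (List.range (f a)).map (g a) := by
  have : Computable fun a =>
      Nat.rec (motive := fun _ => List β) [] (fun i s => s ++ [g a i]) (f a) := by
    refine computable_natRec hf (computable_const _) (computable_list_append (by fun_prop) ?_)
    exact Computable.list_cons.comp (by fun_prop) (computable_const _)
  refine this.of_eq fun a => ?_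
  induction f a with
  | zero => simp
  | succ n ih => rw [List.range_succ, List.map_append, ← ih]; simp

@[fun_prop] theorem computable_evaln (c : Nat.Partrec.Code) {f g : α → ℕ} (hf : Computable f)
    (hg : Computable g) : Computable fun a => Nat.Partrec.Code.evaln (f a) c (g a) :=
  (Nat.Partrec.Code.primrec_evaln.to_comp.comp (((hf.pair (Computable.const c))).pair hg))

end Closure

/-! ### Digits and strings -/

/-- The digit with index `i` of `t` in base `b`. -/
def digit (b t i : ℕ) : ℕ := t / b ^ i % b

theorem digit_lt {b : ℕ} (hb : 0 < b) (t i : ℕ) : digit b t i < b := Nat.mod_lt _ hb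

theorem digit_two_lt (t i : ℕ) : digit 2 t i < 2 := digit_lt two_pos t i

theorem sum_digit (b t n : ℕ) : ∑ i ∈ Finset.range n, digit b t i * b ^ i = t % b ^ n := by
  induction n with
  | zero => simp [Nat.mod_one]
  | succ n ih => rw [Finset.sum_range_succ, ih, Nat.mod_pow_succ, digit, mul_comm]

theorem sum_lt_pow {b : ℕ} {f : ℕ → ℕ} (hf : ∀ i, f i < b) (n : ℕ) :
    ∑ i ∈ Finset.range n, f i * b ^ i < b ^ n := by
  induction n with
  | zero => simp
  | succ n ih =>
    rw [Finset.sum_range_succ, pow_succ]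
    have h1 : (f n + 1) * b ^ n ≤ b * b ^ n := Nat.mul_le_mul_right _ (hf n)
    nlinarith

theorem digit_sum {b : ℕ} {f : ℕ → ℕ} (hf : ∀ i, f i < b) {n i : ℕ} (hi : i < n) :
    digit b (∑ i ∈ Finset.range n, f i * b ^ i) i = f i := by
  have hb : 0 < b := (Nat.zero_le _).trans_lt (hf 0)
  obtain ⟨k, rfl⟩ : ∃ k, n = i + 1 + k := ⟨n - (i + 1), by omega⟩
  rw [digit, Finset.sum_range_add, Finset.sum_range_succ]
  have h1 : ∑ j ∈ Finset.range k, f (i + 1 + j) * b ^ (i + 1 + j)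
      = b ^ i * (b * ∑ j ∈ Finset.range k, f (i + 1 + j) * b ^ j) := by
    rw [Finset.mul_sum, Finset.mul_sum]
    refine Finset.sum_congr rfl fun j _ => ?_
    rw [pow_add, pow_succ]; ring
  rw [h1, mul_comm (f i), add_assoc, ← mul_add, Nat.add_mul_div_left _ _ (pow_pos hb i),
    Nat.div_eq_of_lt (sum_lt_pow hf i), zero_add, Nat.add_mul_mod_self_left,
    Nat.mod_eq_of_lt (hf i)]

theorem digit_mod {b t i n : ℕ} (hi : i < n) : digit b (t % b ^ n) i = digit b t i := by
  rcases Nat.eq_zero_or_pos b with rfl | hb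
  · cases n with
    | zero => omega
    | succ n => simp
  · rw [← sum_digit b t n]
    exact digit_sum (fun i => digit_lt hb t i) hi

@[fun_prop] theorem computable_digit {α : Type*} [Primcodable α] {f g h : α → ℕ}
    (hf : Computable f) (hg : Computable g) (hh : Computable h) :
    Computable fun a => digit (f a) (g a) (h a) := by
  unfold digit; fun_prop

/-- The string of the first `n` binary digits of `u`. -/
def toStr (n u : ℕ) : Str := (List.range n).map fun i => decide (digit 2 u i = 1)

/-- The number whose binary digits are the bits of `w`. -/
def ofStr (w : Str) : ℕ := ∑ i ∈ Finset.range w.length, (w.getD i false).toNat * 2 ^ i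

@[simp] theorem length_toStr (n u : ℕ) : (toStr n u).length = n := by simp [toStr]

theorem toNat_decide_digit (u i : ℕ) : (decide (digit 2 u i = 1)).toNat = digit 2 u i := by
  have := digit_two_lt u i
  interval_cases h : digit 2 u i <;> simp

theorem getD_toStr {n u i : ℕ} (hi : i < n) :
    (toStr n u).getD i false = decide (digit 2 u i = 1) := by
  rw [List.getD_eq_getElem _ _ (by simpa using hi)]
  simp [toStr]

theorem ofStr_toStr (n u : ℕ) : ofStr (toStr n u) = u % 2 ^ n := by
  rw [← sum_digit, ofStr, length_toStr]
  refine Finset.sum_congr rfl fun i hi => ?_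
  rw [getD_toStr (Finset.mem_range.1 hi), toNat_decide_digit]

theorem toStr_injOn {n u v : ℕ} (hu : u < 2 ^ n) (hv : v < 2 ^ n) (h : toStr n u = toStr n v) :
    u = v := by
  have := congrArg ofStr h
  rwa [ofStr_toStr, ofStr_toStr, Nat.mod_eq_of_lt hu, Nat.mod_eq_of_lt hv] at this

theorem ofStr_lt (w : Str) : ofStr w < 2 ^ w.length :=
  sum_lt_pow (fun _ => Bool.toNat_lt _) _

theorem toStr_ofStr (w : Str) : toStr w.length (ofStr w) = w := by
  refine List.ext_getElem (by simp) fun i h1 h2 => ?_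
  rw [← List.getD_eq_getElem _ false h1, ← List.getD_eq_getElem _ false h2, getD_toStr h2, ofStr,
    digit_sum (f := fun i => (w.getD i false).toNat) (fun _ => Bool.toNat_lt _) h2]
  cases w.getD i false <;> simp

@[fun_prop] theorem computable_toStr {α : Type*} [Primcodable α] {f g : α → ℕ}
    (hf : Computable f) (hg : Computable g) : Computable fun a => toStr (f a) (g a) := by
  unfold toStr; fun_prop

@[fun_prop] theorem computable_ofStr {α : Type*} [Primcodable α] {f : α → Str}
    (hf : Computable f) : Computable fun a => ofStr (f a) := by
  unfold ofStr; fun_prop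

/-! ### Balanced tables -/

open Finset in
-- An exponential moment bound for a uniformly random colouring. The cells are independent, and a
-- cell of `B` contributes the factor 1 + 1/|κ| ≤ exp(1/|κ|).
theorem sum_two_pow_count_le {ι κ : Type*} [Fintype ι] [DecidableEq ι] [Fintype κ]
    [DecidableEq κ] (B : Finset ι) (a : κ) :
    ∑ E : ι → κ, (2 : ℝ) ^ #{p ∈ B | E p = a}
      ≤ (Fintype.card κ : ℝ) ^ Fintype.card ι * Real.exp (#B / Fintype.card κ) := by
  have hκ : (0 : ℝ) < Fintype.card κ := by
    exact_mod_cast Fintype.card_pos_iff.2 ⟨a⟩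
  have h1 : ∀ E : ι → κ, (2 : ℝ) ^ #{p ∈ B | E p = a}
      = ∏ p, (if p ∈ B ∧ E p = a then (2 : ℝ) else 1) := by
    intro E
    rw [Finset.prod_ite]
    simp [Finset.filter_and]
    congr 2
    ext p; simp
  have h2 : ∀ p : ι, ∑ c : κ, (if p ∈ B ∧ c = a then (2 : ℝ) else 1)
      ≤ Fintype.card κ * Real.exp (if p ∈ B then 1 / Fintype.card κ else 0) := by
    intro p
    by_cases hp : p ∈ B
    · have : ∀ c : κ, (if p ∈ B ∧ c = a then (2 : ℝ) else 1) = 1 + if c = a then 1 else 0 := by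
        intro c; by_cases hc : c = a <;> simp [hp, hc]; norm_num
      rw [Finset.sum_congr rfl fun c _ => this c, Finset.sum_add_distrib]
      simp only [hp, if_true]
      have := Real.add_one_le_exp (1 / (Fintype.card κ : ℝ))
      calc _ = (Fintype.card κ : ℝ) * (1 / (Fintype.card κ : ℝ) + 1) := by
            simp; field_simp; ring
        _ ≤ _ := by gcongr
    · simp [hp]
  calc ∑ E : ι → κ, (2 : ℝ) ^ #{p ∈ B | E p = a}
      = ∏ p : ι, ∑ c : κ, (if p ∈ B ∧ c = a then (2 : ℝ) else 1) := by
        rw [Finset.prod_univ_sum, Fintype.piFinset_univ]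
        exact Finset.sum_congr rfl fun E _ => h1 E
    _ ≤ ∏ p : ι, (Fintype.card κ * Real.exp (if p ∈ B then 1 / Fintype.card κ else 0)) :=
        Finset.prod_le_prod (fun p _ => Finset.sum_nonneg fun c _ => by positivity)
          fun p _ => h2 p
    _ = _ := by
        rw [Finset.prod_mul_distrib, ← Real.exp_sum]
        simp [div_eq_mul_inv]

open Finset in
/-- There is a two-dimensional table all of whose colours occur in every large rectangle about
as rarely as they should. -/
theorem exists_balanced {n M s : ℕ} (hM : 0 < M) (hs : M * (n + 3) ≤ s) :
    ∃ E : Fin (2 ^ n) × Fin (2 ^ n) → Fin M, ∀ (S T : Finset (Fin (2 ^ n))) (a : Fin M),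
      M * #{p ∈ S ×ˢ T | E p = a} ≤ 3 * ((#S + s) * (#T + s)) := by
  by_contra! hbad
  have hM' : (0 : ℝ) < M := by exact_mod_cast hM
  set L : ℝ := n + 3 with hL
  have hL0 : 0 ≤ L := by positivity
  have hsL : M * L ≤ (s : ℝ) := by rw [hL]; exact_mod_cast hs
  set w : Finset (Fin (2 ^ n)) → Finset (Fin (2 ^ n)) → ℝ := fun S T => (#S + s) * (#T + s)
    with hw
  set r : ℝ := Real.exp (-L) with hr
  -- Markov's inequality and the union bound in one weighted sum: a violated rectangle alone makes
  -- the sum at least 1, while the average of the sum over all `E` turns out to be below 1.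
  have h1 : ∀ E : Fin (2 ^ n) × Fin (2 ^ n) → Fin M,
      (1 : ℝ) ≤ ∑ x : Finset (Fin (2 ^ n)) × Finset (Fin (2 ^ n)) × Fin M,
        2 ^ #{p ∈ x.1 ×ˢ x.2.1 | E p = x.2.2} * Real.exp (-(2 * w x.1 x.2.1 / M)) := by
    intro E
    obtain ⟨S, T, a, h⟩ := hbad E
    refine le_trans ?_ (Finset.single_le_sum
      (f := fun x : Finset (Fin (2 ^ n)) × Finset (Fin (2 ^ n)) × Fin M =>
        (2 : ℝ) ^ #{p ∈ x.1 ×ˢ x.2.1 | E p = x.2.2} * Real.exp (-(2 * w x.1 x.2.1 / M)))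
      (fun x _ => by positivity) (Finset.mem_univ (S, T, a)))
    set q := #{p ∈ S ×ˢ T | E p = a} with hq
    have h' : 3 * w S T < M * q := by
      have : 3 * (((#S : ℝ) + s) * (#T + s)) < M * q := by exact_mod_cast h
      exact this
    have h2 : (2 : ℝ) ^ q = Real.exp (q * Real.log 2) := by
      rw [mul_comm, Real.exp_mul, Real.exp_log two_pos, Real.rpow_natCast]
    change (1 : ℝ) ≤ 2 ^ q * Real.exp (-(2 * w S T / M))
    rw [h2, ← Real.exp_add]
    refine Real.one_le_exp ?_
    -- The factor 3 in the balance condition enters here: 3w < Mq and log 2 > 2/3 give q log 2 ≥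
    -- 2w/M.
    have h3 := Real.log_two_gt_d9
    have h4 : 2 * w S T / M ≤ q * (2 / 3) := by
      rw [div_le_iff₀ hM']; linarith
    have h5 : (q : ℝ) * (2 / 3) ≤ q * Real.log 2 := by gcongr; linarith
    linarith
  have h2 : ∀ x : Finset (Fin (2 ^ n)) × Finset (Fin (2 ^ n)) × Fin M,
      ∑ E : Fin (2 ^ n) × Fin (2 ^ n) → Fin M,
        2 ^ #{p ∈ x.1 ×ˢ x.2.1 | E p = x.2.2} * Real.exp (-(2 * w x.1 x.2.1 / M))
      ≤ (M : ℝ) ^ (2 ^ n * 2 ^ n) * (Real.exp (-(L * s)) * (r ^ #x.1 * r ^ #x.2.1)) := by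
    rintro ⟨S, T, a⟩
    simp only
    rw [← Finset.sum_mul]
    have := sum_two_pow_count_le (S ×ˢ T) a
    simp only [Fintype.card_fin, Fintype.card_prod, card_product, Nat.cast_mul] at this
    refine (mul_le_mul_of_nonneg_right this (Real.exp_pos _).le).trans ?_
    rw [mul_assoc, hr, ← Real.exp_add, ← Real.exp_nat_mul, ← Real.exp_nat_mul, ← Real.exp_add,
      ← Real.exp_add]
    refine mul_le_mul_of_nonneg_left (Real.exp_le_exp.2 (sub_nonneg.1 ?_)) (by positivity)
    -- The slack s in both sides of the rectangle buys the decay exp(-L(|S| + |T| + s)), since M L ≤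
    -- s.
    have h6 : (-(L * s) + ((#S : ℝ) * -L + #T * -L))
        - ((#S : ℝ) * #T / M + -(2 * w S T / M))
        = ((s - M * L) * (#S + #T + s) + w S T) / M := by
      rw [hw]; field_simp; ring
    rw [h6]
    have : 0 ≤ s - M * L := by linarith
    positivity
  have h3 : ∑ x : Finset (Fin (2 ^ n)) × Finset (Fin (2 ^ n)) × Fin M,
      (Real.exp (-(L * s)) * (r ^ #x.1 * r ^ #x.2.1)) < 1 := by
    have hsum : ∑ S : Finset (Fin (2 ^ n)), r ^ #S = (1 + r) ^ (2 ^ n) := by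
      have := Finset.sum_pow_mul_eq_add_pow r 1 (univ : Finset (Fin (2 ^ n)))
      simpa [add_comm] using this
    have e1 : ∑ x : Finset (Fin (2 ^ n)) × Finset (Fin (2 ^ n)) × Fin M,
        (Real.exp (-(L * s)) * (r ^ #x.1 * r ^ #x.2.1))
        = Real.exp (-(L * s)) * (M * ((1 + r) ^ (2 ^ n) * (1 + r) ^ (2 ^ n))) := by
      rw [← Finset.mul_sum]
      congr 1
      rw [Fintype.sum_prod_type]
      simp only [Fintype.sum_prod_type, sum_const, card_univ, Fintype.card_fin, nsmul_eq_mul]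
      rw [← hsum, Finset.sum_mul_sum, Finset.mul_sum]
      exact Finset.sum_congr rfl fun S _ => by rw [Finset.mul_sum]
    -- L = n + 3 makes 2^n exp(-L) at most 1, so that all sets of rows together weigh only a
    -- constant.
    have e2 : (1 + r) ^ (2 ^ n) ≤ Real.exp 1 := by
      have h7 : 1 + r ≤ Real.exp r := by rw [add_comm]; exact Real.add_one_le_exp r
      calc (1 + r) ^ (2 ^ n) ≤ Real.exp r ^ (2 ^ n) := by
            gcongr
        _ = Real.exp ((2 : ℝ) ^ n * r) := by rw [← Real.exp_nat_mul]; push_cast; rfl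
        _ ≤ Real.exp 1 := by
            gcongr
            have h8 : (2 : ℝ) ^ n ≤ Real.exp n := by
              rw [show (n : ℝ) = n * 1 by ring, Real.exp_nat_mul]
              gcongr
              have := Real.add_one_le_exp (1 : ℝ)
              linarith
            calc (2 : ℝ) ^ n * r ≤ Real.exp n * Real.exp (-L) := by rw [hr]; gcongr
              _ = Real.exp (n - L) := by rw [← Real.exp_add]; ring_nf
              _ ≤ 1 := Real.exp_le_one_iff.2 (by rw [hL]; linarith)
    rw [e1]
    have e3 : (M : ℝ) < Real.exp M := by have := Real.add_one_le_exp (M : ℝ); linarith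
    have hM1 : (1 : ℝ) ≤ M := by exact_mod_cast hM
    calc Real.exp (-(L * s)) * (M * ((1 + r) ^ (2 ^ n) * (1 + r) ^ (2 ^ n)))
        ≤ Real.exp (-(L * s)) * (M * (Real.exp 1 * Real.exp 1)) := by gcongr
      _ < Real.exp (-(L * s)) * (Real.exp M * (Real.exp 1 * Real.exp 1)) := by gcongr
      _ = Real.exp (M + 2 - L * s) := by
          rw [← Real.exp_add, ← Real.exp_add, ← Real.exp_add]; ring_nf
      _ ≤ 1 := by
          refine Real.exp_le_one_iff.2 ?_
          have hL3 : 3 ≤ L := by rw [hL]; linarith [(Nat.cast_nonneg n : (0 : ℝ) ≤ n)]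
          have : 3 * M ≤ (s : ℝ) := by nlinarith
          nlinarith
  have h4 : (M : ℝ) ^ (2 ^ n * 2 ^ n) * 1
      ≤ (M : ℝ) ^ (2 ^ n * 2 ^ n) * ∑ x : Finset (Fin (2 ^ n)) × Finset (Fin (2 ^ n)) × Fin M,
      (Real.exp (-(L * s)) * (r ^ #x.1 * r ^ #x.2.1)) := by
    calc (M : ℝ) ^ (2 ^ n * 2 ^ n) * 1
        = ∑ E : Fin (2 ^ n) × Fin (2 ^ n) → Fin M, (1 : ℝ) := by simp
      _ ≤ ∑ E : Fin (2 ^ n) × Fin (2 ^ n) → Fin M, _ := Finset.sum_le_sum fun E _ => h1 E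
      _ = _ := Finset.sum_comm
      _ ≤ _ := Finset.sum_le_sum fun x _ => h2 x
      _ = _ := (Finset.mul_sum _ _ _).symm
  have h5 : (0 : ℝ) < (M : ℝ) ^ (2 ^ n * 2 ^ n) := by positivity
  exact absurd (le_of_mul_le_mul_left h4 h5) (not_le.2 h3)

/-- The colour of the cell `(u, v)` of the table with `N` columns and `M` colours coded by `t`. -/
def tableColor (N M t u v : ℕ) : ℕ := digit M t (u * N + v)

/-- The table coded by `t` has, in every rectangle, few cells of any one colour; sets of rows and
of columns are given as bit masks. -/
def isBalanced (N M s t : ℕ) : Bool :=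
  allBelow (2 ^ N) fun S => allBelow (2 ^ N) fun T => allBelow M fun a =>
    leTest (M * ∑ u ∈ Finset.range N, ∑ v ∈ Finset.range N,
      digit 2 S u * digit 2 T v * (decide (tableColor N M t u v = a)).toNat)
      (3 * ((∑ u ∈ Finset.range N, digit 2 S u + s) * (∑ v ∈ Finset.range N, digit 2 T v + s)))

section Computability

variable {α : Type*} [Primcodable α]

@[fun_prop] theorem computable_tableColor {f g h k l : α → ℕ} (hf : Computable f)
    (hg : Computable g) (hh : Computable h) (hk : Computable k) (hl : Computable l) :
    Computable fun a => tableColor (f a) (g a) (h a) (k a) (l a) := by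
  unfold tableColor; fun_prop

@[fun_prop] theorem computable_isBalanced {f g h k : α → ℕ} (hf : Computable f)
    (hg : Computable g) (hh : Computable h) (hk : Computable k) :
    Computable fun a => isBalanced (f a) (g a) (h a) (k a) := by
  unfold isBalanced; fun_prop

end Computability

/-- The set of the positions below `N` of the ones of the bit mask `S`. -/
def ones (N S : ℕ) : Finset ℕ := {u ∈ Finset.range N | digit 2 S u = 1}

theorem exists_ones_eq {N : ℕ} {F : Finset ℕ} (hF : F ⊆ Finset.range N) :
    ∃ S < 2 ^ N, ones N S = F := by
  classical
  have hlt : ∀ i, (if i ∈ F then 1 else 0) < 2 := fun i => by split_ifs <;> omega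
  refine ⟨_, sum_lt_pow hlt N, ?_⟩
  ext u
  simp only [ones, Finset.mem_filter, Finset.mem_range]
  constructor
  · rintro ⟨hu, h⟩
    rw [digit_sum hlt hu] at h
    by_contra hc
    simp [hc] at h
  · intro hu
    have hu' := Finset.mem_range.1 (hF hu)
    exact ⟨hu', by rw [digit_sum hlt hu']; simp [hu]⟩

theorem sum_digit_two_mul (N S : ℕ) (f : ℕ → ℕ) :
    ∑ u ∈ Finset.range N, digit 2 S u * f u = ∑ u ∈ ones N S, f u := by
  rw [ones, Finset.sum_filter]
  refine Finset.sum_congr rfl fun u _ => ?_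
  have := digit_two_lt S u
  interval_cases h : digit 2 S u <;> simp

/-- The bit masks below 2^N range over all subsets of the rows and columns, so the decidable test
expresses the combinatorial property. -/
theorem isBalanced_iff {N M s t : ℕ} : isBalanced N M s t = true ↔
    ∀ S ⊆ Finset.range N, ∀ T ⊆ Finset.range N, ∀ a < M,
      M * ((S ×ˢ T).filter fun p => tableColor N M t p.1 p.2 = a).card
        ≤ 3 * ((S.card + s) * (T.card + s)) := by
  have key : ∀ S T a : ℕ, (M * ∑ u ∈ Finset.range N, ∑ v ∈ Finset.range N,
      digit 2 S u * digit 2 T v * (decide (tableColor N M t u v = a)).toNat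
      ≤ 3 * ((∑ u ∈ Finset.range N, digit 2 S u + s)
        * (∑ v ∈ Finset.range N, digit 2 T v + s))) ↔
      M * (((ones N S) ×ˢ (ones N T)).filter fun p => tableColor N M t p.1 p.2 = a).card
        ≤ 3 * (((ones N S).card + s) * ((ones N T).card + s)) := by
    intro S T a
    have h1 : ∀ S, ∑ u ∈ Finset.range N, digit 2 S u = (ones N S).card := fun S => by
      simpa using sum_digit_two_mul N S fun _ => 1
    have h2 : ∑ u ∈ Finset.range N, ∑ v ∈ Finset.range N,
        digit 2 S u * digit 2 T v * (decide (tableColor N M t u v = a)).toNat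
        = (((ones N S) ×ˢ (ones N T)).filter fun p => tableColor N M t p.1 p.2 = a).card := by
      simp only [mul_assoc, ← Finset.mul_sum]
      rw [sum_digit_two_mul]
      simp only [sum_digit_two_mul]
      rw [Finset.card_filter, Finset.sum_product]
      refine Finset.sum_congr rfl fun u _ => Finset.sum_congr rfl fun v _ => ?_
      by_cases h : tableColor N M t u v = a <;> simp [h]
    rw [h1, h1, h2]
  simp only [isBalanced, allBelow_eq_true, leTest_eq_true, key]
  constructor
  · intro h S hS T hT a ha
    obtain ⟨S, hS', rfl⟩ := exists_ones_eq hS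
    obtain ⟨T, hT', rfl⟩ := exists_ones_eq hT
    exact h S hS' T hT' a ha
  · intro h S _ T _ a ha
    exact h _ (Finset.filter_subset _ _) _ (Finset.filter_subset _ _) a ha

theorem exists_isBalanced {n M s : ℕ} (hM : 0 < M) (hs : M * (n + 3) ≤ s) :
    ∃ t, isBalanced (2 ^ n) M s t = true := by
  have hN : 0 < 2 ^ n := by positivity
  have hex := exists_balanced hM hs
  generalize 2 ^ n = N at hN hex ⊢
  obtain ⟨E, hE⟩ := hex
  have hpos : ∀ i, i / N % N < N ∧ i % N < N := fun i => ⟨Nat.mod_lt _ hN, Nat.mod_lt _ hN⟩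
  -- Row-major listing of the table; the row index is reduced modulo N so that `g` is defined, and
  -- below M, at every i, as `digit_sum` demands.
  let g : ℕ → ℕ := fun i => E (⟨i / N % N, (hpos i).1⟩, ⟨i % N, (hpos i).2⟩)
  have hg : ∀ i, g i < M := fun i => (E _).2
  refine ⟨∑ i ∈ Finset.range (N * N), g i * M ^ i, isBalanced_iff.2 fun S hS T hT a ha => ?_⟩
  have hcol : ∀ u v : Fin N,
      tableColor N M (∑ i ∈ Finset.range (N * N), g i * M ^ i) u v = E (u, v) := by
    intro u v
    have hlt : (u : ℕ) * N + v < N * N := by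
      have h1 : ((u : ℕ) + 1) * N ≤ N * N := Nat.mul_le_mul_right _ u.2
      have := v.2
      nlinarith
    rw [tableColor, digit_sum hg hlt]
    simp only [g]
    congr 2
    refine Prod.ext (Fin.ext ?_) (Fin.ext ?_)
    · simp only
      rw [mul_comm, Nat.mul_add_div hN, Nat.div_eq_of_lt v.2, add_zero, Nat.mod_eq_of_lt u.2]
    · simp only
      rw [mul_comm, Nat.mul_add_mod, Nat.mod_eq_of_lt v.2]
  have hSN : ∀ u ∈ S, u < N := fun u hu => Finset.mem_range.1 (hS hu)
  have hTN : ∀ u ∈ T, u < N := fun u hu => Finset.mem_range.1 (hT hu)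
  have := hE (S.attachFin hSN) (T.attachFin hTN) ⟨a, ha⟩
  rw [Finset.card_attachFin, Finset.card_attachFin] at this
  refine le_trans (Nat.mul_le_mul_left _ (le_of_eq ?_)) this
  symm
  refine Finset.card_bij (fun p _ => ((p.1 : ℕ), (p.2 : ℕ))) ?_ ?_ ?_
  · rintro ⟨u, v⟩ h
    simp only [Finset.mem_filter, Finset.mem_product, Finset.mem_attachFin] at h ⊢
    exact ⟨h.1, by rw [hcol, h.2]⟩
  · rintro ⟨u, v⟩ _ ⟨u', v'⟩ _ h
    simp only [Prod.mk.injEq] at h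
    exact Prod.ext (Fin.ext h.1) (Fin.ext h.2)
  · rintro ⟨u, v⟩ h
    simp only [Finset.mem_filter, Finset.mem_product] at h
    refine ⟨(⟨u, hSN u h.1.1⟩, ⟨v, hTN v h.1.2⟩), ?_, rfl⟩
    simp only [Finset.mem_filter, Finset.mem_product, Finset.mem_attachFin]
    exact ⟨h.1, Fin.ext ((hcol _ _).symm.trans h.2)⟩

/-! ### The transformation on blocks -/

/-- The ratio of the lengths of consecutive source blocks. -/
def ratio (Q : ℕ) : ℕ := 16 * (Q + 1)

/-- The `j`-th block of the output is a function of the initial segments of the sources of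
length `srcLen Q (j + 1)`. -/
def srcLen (Q j : ℕ) : ℕ := ratio Q ^ (j + 1)

/-- The number of bits in the `j`-th block of the output. -/
def outLen (j : ℕ) : ℕ := (j + 1) ^ 4 - j ^ 4

theorem pow_add_outLen (j : ℕ) : j ^ 4 + outLen j = (j + 1) ^ 4 := by
  have : j ^ 4 ≤ (j + 1) ^ 4 := Nat.pow_le_pow_left (Nat.le_succ j) 4
  rw [outLen]; omega

theorem srcLen_succ (Q j : ℕ) : srcLen Q (j + 1) = ratio Q * srcLen Q j := by
  rw [srcLen, srcLen, pow_succ]; ring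

theorem ratio_pos (Q : ℕ) : 0 < ratio Q := by rw [ratio]; omega

theorem srcLen_mono (Q : ℕ) : Monotone (srcLen Q) := fun _ _ h =>
  Nat.pow_le_pow_right (ratio_pos Q) (by omega)

theorem pow_four_le_srcLen (Q j : ℕ) : (j + 1) ^ 4 ≤ srcLen Q j := by
  calc (j + 1) ^ 4 ≤ (2 ^ (j + 1)) ^ 4 := Nat.pow_le_pow_left (Nat.lt_two_pow_self).le 4
    _ = 16 ^ (j + 1) := by rw [← pow_mul, mul_comm, pow_mul]; norm_num
    _ ≤ srcLen Q j := Nat.pow_le_pow_left (by rw [ratio]; omega) _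

/-- The condition M(n + 3) ≤ s for the table of block j: the block is no longer than n_j, and
n_{j+1} ≤ n_j^2, so s = 2^(3 n_j) is large enough. -/
theorem two_pow_outLen_mul_le (Q j : ℕ) :
    2 ^ outLen j * (srcLen Q (j + 1) + 3) ≤ 2 ^ (3 * srcLen Q j) := by
  set l := srcLen Q j with hl
  have h1 : outLen j ≤ l := (by rw [outLen]; omega : outLen j ≤ (j + 1) ^ 4).trans
    (pow_four_le_srcLen Q j)
  have h2 : ratio Q ≤ l := by
    calc ratio Q = ratio Q ^ 1 := (pow_one _).symm
      _ ≤ l := Nat.pow_le_pow_right (ratio_pos Q) (by omega)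
  have h3 : srcLen Q (j + 1) + 3 ≤ 2 ^ (2 * l) := by
    have h4 : l + 1 ≤ 2 ^ l := Nat.lt_two_pow_self
    have h5 : 16 ≤ ratio Q := by rw [ratio]; omega
    rw [srcLen_succ, two_mul, pow_add]
    nlinarith
  calc 2 ^ outLen j * (srcLen Q (j + 1) + 3) ≤ 2 ^ l * 2 ^ (2 * l) :=
        Nat.mul_le_mul (Nat.pow_le_pow_right two_pos h1) h3
    _ = 2 ^ (3 * l) := by rw [← pow_add]; ring_nf

/-- `t` codes a balanced table for the block with index `q.2`. -/
def isTable (q : ℕ × ℕ) (t : ℕ) : Bool :=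
  isBalanced (2 ^ srcLen q.1 (q.2 + 1)) (2 ^ outLen q.2) (2 ^ (3 * srcLen q.1 q.2)) t

theorem exists_table (q : ℕ × ℕ) : ∃ t, isTable q t = true :=
  exists_isBalanced (by positivity) (two_pow_outLen_mul_le q.1 q.2)

/-- The code of the least balanced table for the `j`-th block. -/
def table (Q j : ℕ) : ℕ := Nat.find (exists_table (Q, j))

/-- The `j`-th block of the output as a number. -/
def block (Q j u v : ℕ) : ℕ :=
  tableColor (2 ^ srcLen Q (j + 1)) (2 ^ outLen j) (table Q j)
    (u % 2 ^ srcLen Q (j + 1)) (v % 2 ^ srcLen Q (j + 1))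

/-- The first `j` blocks of the output as a number with `j ^ 4` binary digits. -/
def blocks (Q j u v : ℕ) : ℕ := ∑ i ∈ Finset.range j, block Q i u v * 2 ^ i ^ 4

section Computability

variable {α : Type*} [Primcodable α]

@[fun_prop] theorem computable_ratio {f : α → ℕ} (hf : Computable f) :
    Computable fun a => ratio (f a) := by
  unfold ratio; fun_prop

@[fun_prop] theorem computable_srcLen {f g : α → ℕ} (hf : Computable f) (hg : Computable g) :
    Computable fun a => srcLen (f a) (g a) := by
  unfold srcLen; fun_prop

@[fun_prop] theorem computable_outLen {f : α → ℕ} (hf : Computable f) :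
    Computable fun a => outLen (f a) := by
  unfold outLen; fun_prop

theorem computable_isTable : Computable fun p : (ℕ × ℕ) × ℕ => isTable p.1 p.2 := by
  unfold isTable; fun_prop

@[fun_prop] theorem computable_table {f g : α → ℕ} (hf : Computable f) (hg : Computable g) :
    Computable fun a => table (f a) (g a) :=
  (computable_find computable_isTable exists_table).comp (hf.pair hg)

@[fun_prop] theorem computable_block {f g h k : α → ℕ} (hf : Computable f)
    (hg : Computable g) (hh : Computable h) (hk : Computable k) :
    Computable fun a => block (f a) (g a) (h a) (k a) := by
  unfold block; fun_prop

@[fun_prop] theorem computable_blocks {f g h k : α → ℕ} (hf : Computable f)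
    (hg : Computable g) (hh : Computable h) (hk : Computable k) :
    Computable fun a => blocks (f a) (g a) (h a) (k a) := by
  unfold blocks; fun_prop

end Computability

theorem block_lt (Q j u v : ℕ) : block Q j u v < 2 ^ outLen j := digit_lt (by positivity) _ _

theorem blocks_succ (Q j u v : ℕ) :
    blocks Q (j + 1) u v = blocks Q j u v + block Q j u v * 2 ^ j ^ 4 :=
  Finset.sum_range_succ _ _

theorem blocks_lt (Q j u v : ℕ) : blocks Q j u v < 2 ^ j ^ 4 := by
  induction j with
  | zero => simp [blocks]
  | succ j ih =>
    rw [blocks_succ, ← pow_add_outLen j, pow_add]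
    have : (block Q j u v + 1) * 2 ^ j ^ 4 ≤ 2 ^ outLen j * 2 ^ j ^ 4 :=
      Nat.mul_le_mul_right _ (block_lt Q j u v)
    nlinarith

/-- The first bits of a source are the low binary digits of its number, so a prefix is a residue
modulo a power of two. -/
theorem block_congr {Q i n u v u' v' : ℕ} (hn : srcLen Q (i + 1) ≤ n)
    (hu : u % 2 ^ n = u' % 2 ^ n) (hv : v % 2 ^ n = v' % 2 ^ n) :
    block Q i u v = block Q i u' v' := by
  have h : 2 ^ srcLen Q (i + 1) ∣ 2 ^ n := pow_dvd_pow _ hn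
  rw [block, block, ← Nat.mod_mod_of_dvd u h, ← Nat.mod_mod_of_dvd v h, hu, hv,
    Nat.mod_mod_of_dvd u' h, Nat.mod_mod_of_dvd v' h]

theorem blocks_congr {Q j n u v u' v' : ℕ} (hn : srcLen Q j ≤ n)
    (hu : u % 2 ^ n = u' % 2 ^ n) (hv : v % 2 ^ n = v' % 2 ^ n) :
    blocks Q j u v = blocks Q j u' v' := by
  refine Finset.sum_congr rfl fun i hi => ?_
  rw [block_congr ((srcLen_mono Q (Finset.mem_range.1 hi)).trans hn) hu hv]

/-- In every rectangle of source segments, every value of the `j`-th block is rare. -/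
theorem card_block_eq_le {Q j : ℕ} {S T : Finset ℕ}
    (hS : S ⊆ Finset.range (2 ^ srcLen Q (j + 1))) (hT : T ⊆ Finset.range (2 ^ srcLen Q (j + 1)))
    {a : ℕ} (ha : a < 2 ^ outLen j) :
    2 ^ outLen j * ((S ×ˢ T).filter fun p => block Q j p.1 p.2 = a).card
      ≤ 3 * ((S.card + 2 ^ (3 * srcLen Q j)) * (T.card + 2 ^ (3 * srcLen Q j))) := by
  refine le_of_eq_of_le ?_
    (isBalanced_iff.1 (Nat.find_spec (exists_table (Q, j))) S hS T hT a ha)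
  congr 2
  refine Finset.filter_congr fun p hp => ?_
  rw [Finset.mem_product] at hp
  rw [block, Nat.mod_eq_of_lt (Finset.mem_range.1 (hS hp.1)),
    Nat.mod_eq_of_lt (Finset.mem_range.1 (hT hp.2)), table]

/-- The bit with index `k` of the output, as a number. -/
def outBit (Q k u v : ℕ) : ℕ := digit 2 (block Q k.sqrt.sqrt u v) (k - k.sqrt.sqrt ^ 4)

@[fun_prop] theorem computable_outBit {α : Type*} [Primcodable α] {f g h k : α → ℕ}
    (hf : Computable f) (hg : Computable g) (hh : Computable h) (hk : Computable k) :
    Computable fun a => outBit (f a) (g a) (h a) (k a) := by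
  unfold outBit; fun_prop

theorem le_sqrt_sqrt {j k : ℕ} : j ≤ k.sqrt.sqrt ↔ j ^ 4 ≤ k := by
  rw [Nat.le_sqrt', Nat.le_sqrt', ← pow_mul]

/-- The bits of `blocks` are those of `outBit`. -/
theorem digit_blocks {Q j k u v : ℕ} (hk : k < j ^ 4) :
    digit 2 (blocks Q j u v) k = outBit Q k u v := by
  induction j with
  | zero => simp at hk
  | succ j ih =>
    by_cases h : k < j ^ 4
    · rw [← ih h, ← digit_mod h, blocks_succ, Nat.add_mul_mod_self_right, digit_mod h]
    · have h1 : k.sqrt.sqrt = j := by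
        refine le_antisymm ?_ (le_sqrt_sqrt.2 (not_lt.1 h))
        rw [← Nat.lt_succ_iff, ← not_le, le_sqrt_sqrt, not_le]
        exact hk
      obtain ⟨i, rfl⟩ := Nat.exists_eq_add_of_le (not_lt.1 h)
      rw [outBit, h1, Nat.add_sub_cancel_left, blocks_succ, digit, pow_add, ← Nat.div_div_eq_div_mul,
        Nat.add_mul_div_right _ _ (by positivity), Nat.div_eq_of_lt (blocks_lt Q j u v), zero_add,
        digit]

/-! ### The machine -/

/-- The number whose binary digits are the first `n` bits of `x`. -/
def BinSeq.prefixNum (x : BinSeq) (n : ℕ) : ℕ := ∑ i ∈ Finset.range n, x.answer i * 2 ^ i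

theorem BinSeq.answer_lt (x : BinSeq) (i : ℕ) : x.answer i < 2 := Bool.toNat_lt _

theorem BinSeq.prefixNum_lt (x : BinSeq) (n : ℕ) : x.prefixNum n < 2 ^ n :=
  sum_lt_pow x.answer_lt n

theorem BinSeq.digit_prefixNum (x : BinSeq) {n i : ℕ} (hi : i < n) :
    digit 2 (x.prefixNum n) i = x.answer i :=
  digit_sum x.answer_lt hi

theorem BinSeq.prefixNum_mod (x : BinSeq) {m n : ℕ} (h : m ≤ n) :
    x.prefixNum n % 2 ^ m = x.prefixNum m := by
  rw [← sum_digit]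
  refine Finset.sum_congr rfl fun i hi => ?_
  rw [x.digit_prefixNum ((Finset.mem_range.1 hi).trans_le h)]

theorem toStr_eq_initSeg {u n : ℕ} {z : BinSeq} (h : ∀ i < n, digit 2 u i = z.answer i) :
    toStr n u = z.initSeg n := by
  refine List.ext_getElem (by simp [BinSeq.initSeg]) fun i h1 h2 => ?_
  have hi : i < n := by simpa using h1
  simp only [toStr, BinSeq.initSeg, List.getElem_map, List.getElem_range, List.getElem_ofFn, h i hi,
    BinSeq.answer]
  cases z i <;> simp

theorem BinSeq.toStr_prefixNum (x : BinSeq) (n : ℕ) : toStr n (x.prefixNum n) = x.initSeg n :=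
  toStr_eq_initSeg fun _ hi => x.digit_prefixNum hi

@[simp] theorem BinSeq.length_initSeg (x : BinSeq) (n : ℕ) : (x.initSeg n).length = n := by
  simp [BinSeq.initSeg]

namespace OracleMachine

/-- One program must serve all oracles at once, so the quantifier over the oracles stands inside. -/
theorem exists_eval_eq_of_partrec {g : ℕ →. ℕ} (hg : Nat.Partrec g) :
    ∃ M : OracleMachine, ∀ x y, M.eval x y = g := by
  induction hg with
  | zero => exact ⟨.zero, fun _ _ => rfl⟩
  | succ => exact ⟨.succ, fun _ _ => rfl⟩
  | left => exact ⟨.left, fun _ _ => rfl⟩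
  | right => exact ⟨.right, fun _ _ => rfl⟩
  | pair _ _ hf hg =>
    obtain ⟨M, hM⟩ := hf
    obtain ⟨N, hN⟩ := hg
    exact ⟨.pair M N, fun x y => by simp only [eval, hM, hN]; rfl⟩
  | comp _ _ hf hg =>
    obtain ⟨M, hM⟩ := hf
    obtain ⟨N, hN⟩ := hg
    exact ⟨.comp M N, fun x y => by simp only [eval, hM, hN]; rfl⟩
  | prec _ _ hf hg =>
    obtain ⟨M, hM⟩ := hf
    obtain ⟨N, hN⟩ := hg
    exact ⟨.prec M N, fun x y => by simp only [eval, hM, hN]; rfl⟩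
  | rfind _ hf =>
    obtain ⟨M, hM⟩ := hf
    exact ⟨.rfind M, fun x y => by simp only [eval, hM]; rfl⟩

/-- `M` computes, uniformly in the oracles, the total function `g x y`. -/
def Computes (M : OracleMachine) (g : BinSeq → BinSeq → ℕ → ℕ) : Prop :=
  ∀ x y n, M.eval x y n = Part.some (g x y n)

theorem exists_computes {g : ℕ → ℕ} (hg : Computable g) :
    ∃ M : OracleMachine, M.Computes fun _ _ => g := by
  obtain ⟨M, hM⟩ := exists_eval_eq_of_partrec (Partrec.nat_iff.1 hg)
  exact ⟨M, fun x y n => by rw [hM]; rfl⟩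

theorem Computes.comp {M N : OracleMachine} {g h : BinSeq → BinSeq → ℕ → ℕ}
    (hM : M.Computes g) (hN : N.Computes h) :
    (OracleMachine.comp M N).Computes fun x y n => g x y (h x y n) := fun x y n =>
  (congrArg (· >>= eval x y M) (hN x y n)).trans ((Part.bind_some _ _).trans (hM x y _))

theorem Computes.pair {M N : OracleMachine} {g h : BinSeq → BinSeq → ℕ → ℕ}
    (hM : M.Computes g) (hN : N.Computes h) :
    (OracleMachine.pair M N).Computes fun x y n => Nat.pair (g x y n) (h x y n) := fun x y n => by
  simp [eval, hN x y n, hM x y n, Seq.seq]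

theorem Computes.prec {M N : OracleMachine} {g h : BinSeq → BinSeq → ℕ → ℕ}
    (hM : M.Computes g) (hN : N.Computes h) :
    (OracleMachine.prec M N).Computes fun x y p =>
      Nat.rec (motive := fun _ => ℕ) (g x y p.unpair.1)
        (fun k r => h x y (Nat.pair p.unpair.1 (Nat.pair k r))) p.unpair.2 := fun x y p => by
  simp only [eval]
  induction p.unpair.2 with
  | zero => exact hM x y _
  | succ k ih =>
    simp only at ih ⊢
    rw [ih]
    simp [hN x y]

/-- A machine that reads an initial segment of the sequence answering the queries of `O`. -/
theorem exists_computes_prefixNum {O : OracleMachine} {z : BinSeq → BinSeq → BinSeq}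
    (hO : O.Computes fun x y => (z x y).answer) :
    ∃ M : OracleMachine, M.Computes fun x y => (z x y).prefixNum := by
  obtain ⟨A, hA⟩ := exists_computes (g := fun n => n.unpair.2.unpair.1) (by fun_prop)
  obtain ⟨B, hB⟩ := exists_computes (g := fun n => n) (by fun_prop)
  obtain ⟨C, hC⟩ := exists_computes
    -- The input is the answer to query k paired with the recursion data (0, (k, r)), where r is the
    -- sum so far; the 0 is a dummy parameter of the primitive recursion.
    (g := fun n => n.unpair.2.unpair.2.unpair.2 + n.unpair.1 * 2 ^ n.unpair.2.unpair.2.unpair.1)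
    (by fun_prop)
  obtain ⟨D, hD⟩ := exists_computes (g := fun n => Nat.pair 0 n) (by fun_prop)
  obtain ⟨Z, hZ⟩ := exists_computes (g := fun _ => 0) (by fun_prop)
  refine ⟨_, fun x y n => ((hZ.prec (hC.comp ((hO.comp hA).pair hB))).comp hD x y n).trans ?_⟩
  congr 1
  simp only [Nat.unpair_pair]
  induction n with
  | zero => simp [BinSeq.prefixNum]
  | succ n ih => rw [BinSeq.prefixNum, Finset.sum_range_succ, ← BinSeq.prefixNum, ← ih]

end OracleMachine

/-- The length of the initial segments of the sources that determine the output bit `k`. -/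
def queryLen (Q k : ℕ) : ℕ := srcLen Q (k.sqrt.sqrt + 1)

@[fun_prop] theorem computable_queryLen {α : Type*} [Primcodable α] {f g : α → ℕ}
    (hf : Computable f) (hg : Computable g) : Computable fun a => queryLen (f a) (g a) := by
  unfold queryLen; fun_prop

/-- The transformation that increases the randomness rate of a pair of independent sequences. -/
def extract (τ : ℚ) (x y : BinSeq) : BinSeq := fun k =>
  decide (outBit τ.den k (x.prefixNum (queryLen τ.den k)) (y.prefixNum (queryLen τ.den k)) = 1)

theorem exists_represents_extract : ∃ M : OracleMachine, M.Represents extract := by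
  obtain ⟨A, hA⟩ := OracleMachine.exists_computes_prefixNum
    (O := .oracle₁) (z := fun x _ => x) fun _ _ _ => rfl
  obtain ⟨B, hB⟩ := OracleMachine.exists_computes_prefixNum
    (O := .oracle₂) (z := fun _ y => y) fun _ _ _ => rfl
  obtain ⟨L, hL⟩ := OracleMachine.exists_computes
    (g := fun n => queryLen n.unpair.1.unpair.2 n.unpair.2) (by fun_prop)
  obtain ⟨I, hI⟩ := OracleMachine.exists_computes (g := fun n => n) (by fun_prop)
  obtain ⟨C, hC⟩ := OracleMachine.exists_computes
    (g := fun n => outBit n.unpair.1.unpair.1.unpair.2 n.unpair.1.unpair.2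
      n.unpair.2.unpair.1 n.unpair.2.unpair.2) (by fun_prop)
  have hM := hC.comp (hI.pair ((hA.comp hL).pair (hB.comp hL)))
  refine ⟨C.comp (I.pair ((A.comp L).pair (B.comp L))), fun τ x y n => ?_⟩
  rw [hM x y]
  simp only [OracleMachine.input, Nat.unpair_pair, Part.mem_some_iff, extract]
  exact toNat_decide_digit _ _

theorem OracleMachine.Represents.isTruthTable {M : OracleMachine}
    {f : ℚ → BinSeq → BinSeq → BinSeq} (h : M.Represents f) : M.IsTruthTable :=
  fun τ n x y => Part.dom_iff_mem.2 ⟨_, h τ x y n⟩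

/-- The first `j` blocks of the output. -/
theorem initSeg_extract (τ : ℚ) (x y : BinSeq) {j n : ℕ} (hn : srcLen τ.den j ≤ n) :
    toStr (j ^ 4) (blocks τ.den j (x.prefixNum n) (y.prefixNum n))
      = (extract τ x y).initSeg (j ^ 4) := by
  refine toStr_eq_initSeg fun k hk => ?_
  have h1 : k.sqrt.sqrt + 1 ≤ j := by
    rw [Nat.succ_le_iff, ← not_le, le_sqrt_sqrt, not_le]; exact hk
  have h2 : queryLen τ.den k ≤ n := (srcLen_mono _ h1).trans hn
  rw [digit_blocks hk, BinSeq.answer, extract, outBit, outBit, toNat_decide_digit,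
    block_congr (le_refl (queryLen τ.den k))
      (((x.prefixNum_mod h2).trans (Nat.mod_eq_of_lt (x.prefixNum_lt _)).symm))
      (((y.prefixNum_mod h2).trans (Nat.mod_eq_of_lt (y.prefixNum_lt _)).symm))]

open Encodable Nat.Partrec

/-! ### Descriptions -/

variable {U : Str →. Str}

theorem IsUniversal.exists_program (hU : IsUniversal U) (x : Str) :
    ∃ p, x ∈ U p ∧ p.length = K U x := by
  have h := hU.complexity_ne_top x
  have hne : Nonempty {p : Str // x ∈ U p} := by
    by_contra hc
    rw [not_nonempty_iff] at hc
    exact h (iInf_of_empty _)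
  obtain ⟨p, hp⟩ := ciInf_mem fun p : {p : Str // x ∈ U p} => ((p : Str).length : ℕ∞)
  refine ⟨p, p.2, ?_⟩
  rw [K, complexity, ← hp, ENat.toNat_natCast]

theorem K_le_length {p x : Str} (h : x ∈ U p) :
    K U x ≤ p.length :=
  ENat.toNat_le_of_le_natCast (complexity_le h)

theorem IsUniversal.exists_K_le (hU : IsUniversal U) {M : Str →. Str} (hM : Partrec M) :
    ∃ c : ℕ, ∀ p x, x ∈ M p → K U x ≤ p.length + c := by
  obtain ⟨c, hc⟩ := hU.optimal M hM
  refine ⟨c, fun p x hx => ENat.toNat_le_of_le_natCast ((hc x).trans ?_)⟩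
  push_cast
  gcongr
  exact complexity_le hx

theorem IsUniversal.exists_K_le_length (hU : IsUniversal U) :
    ∃ c : ℕ, ∀ x : Str, K U x ≤ x.length + c := by
  obtain ⟨c, hc⟩ := hU.exists_K_le (M := fun p => Part.some p) Computable.id
  exact ⟨c, fun x => hc x x (Part.mem_some x)⟩

theorem IsUniversal.exists_K_map_le (hU : IsUniversal U) {g : Str → Str} (hg : Computable g) :
    ∃ c : ℕ, ∀ x : Str, K U (g x) ≤ K U x + c := by
  obtain ⟨c, hc⟩ := hU.exists_K_le (M := fun p => (U p).map g)
    (hU.partrec.map (hg.comp Computable.snd))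
  refine ⟨c, fun x => ?_⟩
  obtain ⟨p, hp, hl⟩ := hU.exists_program x
  rw [← hl]
  exact hc p (g x) (Part.mem_map g hp)

/-! ### Describing elements of enumerable sets by their rank. -/

section Enumeration

variable (R : ℕ → ℕ → ℕ → Bool)

/-- The stage `e.unpair.2` is the first one at which `e.unpair.1` is enumerated. -/
def isFirst (p e : ℕ) : Bool :=
  R p e.unpair.1 e.unpair.2 && allBelow e.unpair.2 fun t => !(R p e.unpair.1 t)

/-- The number of objects enumerated before the event `e`. -/
def enumRank (p e : ℕ) : ℕ := ∑ i ∈ Finset.range e, (isFirst R p i).toNat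

variable {R}

theorem computable_isFirst (hR : Computable fun q : ℕ × ℕ × ℕ => R q.1 q.2.1 q.2.2) :
    Computable fun q : ℕ × ℕ => isFirst R q.1 q.2 := by
  have h1 : Computable fun q : ℕ × ℕ => R q.1 q.2.unpair.1 q.2.unpair.2 :=
    hR.comp (f := fun q : ℕ × ℕ × ℕ => R q.1 q.2.1 q.2.2)
      (g := fun q : ℕ × ℕ => (q.1, q.2.unpair.1, q.2.unpair.2)) (by fun_prop)
  have h2 : Computable fun q : (ℕ × ℕ) × ℕ => R q.1.1 q.1.2.unpair.1 q.2 :=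
    hR.comp (f := fun q : ℕ × ℕ × ℕ => R q.1 q.2.1 q.2.2)
      (g := fun q : (ℕ × ℕ) × ℕ => (q.1.1, q.1.2.unpair.1, q.2)) (by fun_prop)
  unfold isFirst
  fun_prop

theorem computable_enumRank (hR : Computable fun q : ℕ × ℕ × ℕ => R q.1 q.2.1 q.2.2) :
    Computable fun q : ℕ × ℕ => enumRank R q.1 q.2 := by
  have h : Computable fun q : (ℕ × ℕ) × ℕ => isFirst R q.1.1 q.2 :=
    (computable_isFirst hR).comp (g := fun q : (ℕ × ℕ) × ℕ => (q.1.1, q.2)) (by fun_prop)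
  unfold enumRank
  fun_prop

theorem isFirst_injOn {p e e' : ℕ} (h : isFirst R p e = true) (h' : isFirst R p e' = true)
    (he : e.unpair.1 = e'.unpair.1) : e = e' := by
  simp only [isFirst, Bool.and_eq_true, allBelow_eq_true, Bool.not_eq_true'] at h h'
  have : e.unpair.2 = e'.unpair.2 := by
    rcases lt_trichotomy e.unpair.2 e'.unpair.2 with hlt | heq | hlt
    · have := h'.2 _ hlt; rw [← he, h.1] at this; simp at this
    · exact heq
    · have := h.2 _ hlt; rw [he, h'.1] at this; simp at this
  rw [← Nat.pair_unpair e, ← Nat.pair_unpair e', he, this]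

/-- Every object has only one first event, so mapping events to objects is injective. It suffices
that `W` contains the enumerated set. -/
theorem enumRank_le_card {p : ℕ} {W : Finset ℕ} (hW : ∀ w t, R p w t = true → w ∈ W) (e : ℕ) :
    enumRank R p e ≤ W.card := by
  have h1 : enumRank R p e = ((Finset.range e).filter fun i => isFirst R p i = true).card := by
    rw [Finset.card_filter, enumRank]
    refine Finset.sum_congr rfl fun i _ => ?_
    cases isFirst R p i <;> simp
  rw [h1]
  refine Finset.card_le_card_of_injOn (fun i => i.unpair.1) ?_ ?_
  · intro i hi
    have := (Finset.mem_filter.1 hi).2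
    rw [isFirst, Bool.and_eq_true] at this
    exact hW _ _ this.1
  · intro i hi i' hi' h
    exact isFirst_injOn (Finset.mem_filter.1 hi).2 (Finset.mem_filter.1 hi').2 h

theorem enumRank_lt {p e e' : ℕ} (h : isFirst R p e = true) (he : e < e') :
    enumRank R p e < enumRank R p e' := by
  have h1 : enumRank R p (e + 1) = enumRank R p e + 1 := by
    rw [enumRank, Finset.sum_range_succ, h]; rfl
  have h2 : enumRank R p (e + 1) ≤ enumRank R p e' :=
    Finset.sum_le_sum_of_subset (Finset.range_subset_range.2 he)
  omega

/-- An element of an enumerable set is described by the parameters of the set and its position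
in the enumeration. -/
theorem IsUniversal.exists_K_enum_le (hU : IsUniversal U)
    (hR : Computable fun q : ℕ × ℕ × ℕ => R q.1 q.2.1 q.2.2) {out : ℕ → ℕ → Str}
    (hout : Computable fun q : ℕ × ℕ => out q.1 q.2) :
    ∃ c : ℕ, ∀ (p w t l κ μ : ℕ) (W : Finset ℕ), p < 2 ^ l →
      (∀ w t, R p w t = true → w ∈ W) → R p w t = true → W.card * 2 ^ μ < 2 ^ κ →
      K U (out p w) + μ ≤ κ + 2 * l + c := by
  have h1 : Computable fun q : Str × ℕ =>
      isFirst R (ofStr (q.1.drop (q.1.idxOf false + 1)) % 2 ^ q.1.idxOf false) q.2 :=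
    (computable_isFirst hR).comp (g := fun q : Str × ℕ =>
      (ofStr (q.1.drop (q.1.idxOf false + 1)) % 2 ^ q.1.idxOf false, q.2)) (by fun_prop)
  have h2 : Computable fun q : Str × ℕ =>
      enumRank R (ofStr (q.1.drop (q.1.idxOf false + 1)) % 2 ^ q.1.idxOf false) q.2 :=
    (computable_enumRank hR).comp (g := fun q : Str × ℕ =>
      (ofStr (q.1.drop (q.1.idxOf false + 1)) % 2 ^ q.1.idxOf false, q.2)) (by fun_prop)
  have h3 : Computable fun q : Str × ℕ =>
      out (ofStr (q.1.drop (q.1.idxOf false + 1)) % 2 ^ q.1.idxOf false) q.2.unpair.1 :=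
    hout.comp (g := fun q : Str × ℕ =>
      (ofStr (q.1.drop (q.1.idxOf false + 1)) % 2 ^ q.1.idxOf false, q.2.unpair.1)) (by fun_prop)
  have h4 : Computable fun q : Str × ℕ =>
      isFirst R (ofStr (q.1.drop (q.1.idxOf false + 1)) % 2 ^ q.1.idxOf false) q.2 &&
      decide (enumRank R (ofStr (q.1.drop (q.1.idxOf false + 1)) % 2 ^ q.1.idxOf false) q.2
        = ofStr (q.1.drop (q.1.idxOf false + 1)) / 2 ^ q.1.idxOf false) := by
    fun_prop
  obtain ⟨c, hc⟩ := hU.exists_K_le ((partrec_rfind (p := fun (s : Str) e =>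
      isFirst R (ofStr (s.drop (s.idxOf false + 1)) % 2 ^ s.idxOf false) e &&
      decide (enumRank R (ofStr (s.drop (s.idxOf false + 1)) % 2 ^ s.idxOf false) e
        = ofStr (s.drop (s.idxOf false + 1)) / 2 ^ s.idxOf false)) h4).map
    (g := fun (s : Str) (e : ℕ) => out (ofStr (s.drop (s.idxOf false + 1)) % 2 ^ s.idxOf false)
      e.unpair.1) h3)
  refine ⟨c + 1, fun p w t l κ μ W hp hW hw hcard => ?_⟩
  have hex : ∃ t, R p w t = true := ⟨t, hw⟩
  set e := Nat.pair w (Nat.find hex) with he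
  have hfirst : isFirst R p e = true := by
    simp only [isFirst, he, Nat.unpair_pair, Bool.and_eq_true, allBelow_eq_true,
      Bool.not_eq_true']
    exact ⟨Nat.find_spec hex, fun i hi => by simpa using Nat.find_min hex hi⟩
  have hrank : enumRank R p e < W.card :=
    (enumRank_lt hfirst (Nat.lt_succ_self e)).trans_le (enumRank_le_card hW _)
  -- The enumeration is nonempty, so the cardinality bound forces a positive difference κ - μ; it
  -- becomes `d + 1`.
  have hμ : μ < κ := by
    rw [← Nat.pow_lt_pow_iff_right (one_lt_two)]
    refine lt_of_le_of_lt ?_ hcard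
    exact Nat.le_mul_of_pos_left _ ((Nat.zero_le _).trans_lt hrank)
  obtain ⟨d, rfl⟩ := Nat.exists_eq_add_of_lt hμ
  have hrank' : enumRank R p e < 2 ^ (d + 1) := by
    refine hrank.trans ?_
    rw [add_assoc, pow_add, mul_comm] at hcard
    exact lt_of_mul_lt_mul_left hcard (Nat.zero_le _)
  -- Rank and parameter share one number of d + 1 + l bits. The unary prefix of the program gives l,
  -- which tells where to split it; with its delimiter it accounts for the second l and one more
  -- bit.
  set r := enumRank R p e * 2 ^ l + p with hr
  have hr_lt : r < 2 ^ (d + 1 + l) := by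
    rw [pow_add]
    have := Nat.mul_le_mul_right (2 ^ l) hrank'
    rw [Nat.succ_mul] at this
    omega
  have hr_mod : r % 2 ^ l = p := by
    rw [hr, Nat.mul_add_mod_self_right, Nat.mod_eq_of_lt hp]
  have hr_div : r / 2 ^ l = enumRank R p e := by
    rw [hr, mul_comm, Nat.mul_add_div (by positivity), Nat.div_eq_of_lt hp, add_zero]
  set s : Str := List.replicate l true ++ false :: toStr (d + 1 + l) r with hs
  have hidx : s.idxOf false = l := by
    rw [hs, List.idxOf_append_of_notMem (by simp [List.mem_replicate])]
    simp
  have hval : ofStr (s.drop (l + 1)) = r := by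
    rw [hs, List.drop_append]
    simp only [List.drop_replicate, List.length_replicate]
    simp [ofStr_toStr, Nat.mod_eq_of_lt hr_lt]
  have hlen : s.length = l + 1 + (d + 1 + l) := by
    rw [hs]; simp; ring
  have := hc s (out p w) (by
    refine (Part.mem_map_iff _).2 ⟨e, Nat.mem_rfind.2 ⟨?_, fun {m} hm => ?_⟩, ?_⟩
    · simp [hidx, hval, hr_mod, hr_div, hfirst]
    · simp only [hidx, hval, hr_mod, hr_div, PFun.coe_val, Part.mem_some_iff]
      symm
      rw [Bool.and_eq_false_iff]
      by_cases hf : isFirst R p m = true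
      · right
        simpa using (enumRank_lt hf hm).ne
      · left
        simpa using hf
    · simp only [hidx, hval, hr_mod, he, Nat.unpair_pair])
  rw [hlen] at this
  omega

end Enumeration

/-! ### Approximating the complexity from above -/

/-- Step-bounded evaluation makes the graph of `U` an increasing union of decidable stages, which
all the enumerations below use. -/
theorem exists_code (hU : Partrec U) :
    ∃ c : Code, ∀ p w : Str, w ∈ U p ↔ ∃ t, Code.evaln t c (encode p) = some (encode w) := by
  obtain ⟨c, hc⟩ := Code.exists_code.1 hU
  refine ⟨c, fun p w => ?_⟩
  have h1 : ∀ t, Code.evaln t c (encode p) = some (encode w)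
      ↔ encode w ∈ Code.evaln t c (encode p) := fun t => Iff.rfl
  simp only [h1]
  rw [← Code.evaln_complete, hc]
  simp

/-- By stage `t`, a program of length at most `k` for `w` is found. -/
def approx (c : Code) (t k : ℕ) (w : Str) : Bool :=
  anyBelow (k + 1) fun a => anyBelow (2 ^ a) fun b =>
    decide (Code.evaln t c (encode (toStr a b)) = some (encode w))

@[fun_prop] theorem computable_approx {α : Type*} [Primcodable α] (c : Code) {f g : α → ℕ}
    {h : α → Str} (hf : Computable f) (hg : Computable g) (hh : Computable h) :
    Computable fun a => approx c (f a) (g a) (h a) := by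
  unfold approx; fun_prop

theorem approx_eq_true {c : Code} {t k : ℕ} {w : Str} : approx c t k w = true ↔
    ∃ p : Str, p.length ≤ k ∧ Code.evaln t c (encode p) = some (encode w) := by
  simp only [approx, anyBelow_eq_true, decide_eq_true_eq]
  constructor
  · rintro ⟨a, ha, b, _, h⟩
    exact ⟨toStr a b, by simpa using Nat.lt_succ_iff.1 ha, h⟩
  · rintro ⟨p, hp, h⟩
    exact ⟨p.length, Nat.lt_succ_iff.2 hp, ofStr p, ofStr_lt p, by rw [toStr_ofStr]; exact h⟩

theorem approx_mono {c : Code} {t t' k : ℕ} {w : Str} (ht : t ≤ t')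
    (h : approx c t k w = true) : approx c t' k w = true := by
  rw [approx_eq_true] at h ⊢
  obtain ⟨p, hp, h⟩ := h
  exact ⟨p, hp, Code.evaln_mono ht h⟩

theorem IsUniversal.exists_approx_iff (hU : IsUniversal U) {c : Code}
    (hc : ∀ p w : Str, w ∈ U p ↔ ∃ t, Code.evaln t c (encode p) = some (encode w))
    {k : ℕ} {w : Str} : (∃ t, approx c t k w = true) ↔ K U w ≤ k := by
  simp only [approx_eq_true]
  constructor
  · rintro ⟨t, p, hp, h⟩
    exact (K_le_length ((hc p w).2 ⟨t, h⟩)).trans hp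
  · intro h
    obtain ⟨p, hp, hl⟩ := hU.exists_program w
    obtain ⟨t, ht⟩ := (hc p w).1 hp
    exact ⟨t, p, hl.trans_le h, ht⟩

/-- There are only 2^(k+1) - 1 programs of length at most k, and each prints at most one string. -/
theorem IsUniversal.card_lt (hU : IsUniversal U) {k : ℕ} {F : Finset Str}
    (hF : ∀ w ∈ F, K U w ≤ k) : F.card < 2 ^ (k + 1) := by
  classical
  let g : ℕ → ℕ → Str := fun a b =>
    if h : (U (toStr a b)).Dom then (U (toStr a b)).get h else []
  have hsub : F ⊆ (Finset.range (k + 1)).biUnion fun a => (Finset.range (2 ^ a)).image (g a) := by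
    intro w hw
    obtain ⟨p, hp, hl⟩ := hU.exists_program w
    rw [Finset.mem_biUnion]
    refine ⟨p.length, Finset.mem_range.2 (Nat.lt_succ_iff.2 (hl.trans_le (hF w hw))), ?_⟩
    refine Finset.mem_image.2 ⟨ofStr p, Finset.mem_range.2 (ofStr_lt p), ?_⟩
    simp only [g, toStr_ofStr]
    rw [dif_pos hp.1]
    exact hp.2
  calc F.card ≤ _ := Finset.card_le_card hsub
    _ ≤ ∑ a ∈ Finset.range (k + 1), ((Finset.range (2 ^ a)).image (g a)).card :=
        Finset.card_biUnion_le
    _ ≤ ∑ a ∈ Finset.range (k + 1), 2 ^ a :=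
        Finset.sum_le_sum fun a _ => Finset.card_image_le.trans (Finset.card_range _).le
    _ < 2 ^ (k + 1) := by
        rw [Nat.geomSum_eq le_rfl]
        have : 0 < 2 ^ (k + 1) := by positivity
        omega

/-! ### The complexity of one more block -/

/-- The number of extensions of the first `j` blocks, given by `w`, by one block to a string of
complexity at most `k`, as far as they are found by stage `t`. -/
def stageDeg (c : Code) (t k j w : ℕ) : ℕ :=
  ∑ a ∈ Finset.range (2 ^ outLen j), (approx c t k (toStr ((j + 1) ^ 4) (w + a * 2 ^ j ^ 4))).toNat

@[fun_prop] theorem computable_stageDeg {α : Type*} [Primcodable α] (c : Code) {f g h k : α → ℕ}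
    (hf : Computable f) (hg : Computable g) (hh : Computable h) (hk : Computable k) :
    Computable fun a => stageDeg c (f a) (g a) (h a) (k a) := by
  unfold stageDeg; fun_prop

theorem stageDeg_eq_card (c : Code) (t k j w : ℕ) : stageDeg c t k j w =
    ((Finset.range (2 ^ outLen j)).filter fun a =>
      approx c t k (toStr ((j + 1) ^ 4) (w + a * 2 ^ j ^ 4)) = true).card := by
  rw [Finset.card_filter, stageDeg]
  refine Finset.sum_congr rfl fun i _ => ?_
  cases approx c t k (toStr ((j + 1) ^ 4) (w + i * 2 ^ j ^ 4)) <;> simp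

theorem natPair_lt_two_pow {a b l : ℕ} (ha : a < 2 ^ l) (hb : b < 2 ^ l) :
    Nat.pair a b < 2 ^ (2 * l) := by
  refine (Nat.pair_lt_max_add_one_sq a b).trans_le ?_
  rw [mul_comm, pow_mul]
  exact Nat.pow_le_pow_left (max_lt ha hb) 2

theorem extension_lt {j w a : ℕ} (hw : w < 2 ^ j ^ 4) (ha : a < 2 ^ outLen j) :
    w + a * 2 ^ j ^ 4 < 2 ^ (j + 1) ^ 4 := by
  rw [← pow_add_outLen j, pow_add]
  have := Nat.mul_le_mul_right (2 ^ j ^ 4) ha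
  rw [Nat.succ_mul] at this
  nlinarith

/-- Few strings have many simple extensions. -/
theorem IsUniversal.card_mul_two_pow_lt (hU : IsUniversal U) {j k d : ℕ} {W : Finset ℕ}
    (hlt : ∀ w ∈ W, w < 2 ^ j ^ 4)
    (hW : ∀ w ∈ W, ∃ A ⊆ Finset.range (2 ^ outLen j), 2 ^ d ≤ A.card ∧
      ∀ a ∈ A, K U (toStr ((j + 1) ^ 4) (w + a * 2 ^ j ^ 4)) ≤ k) :
    W.card * 2 ^ d < 2 ^ (k + 1) := by
  classical
  set P := (W ×ˢ Finset.range (2 ^ outLen j)).filter fun q =>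
    K U (toStr ((j + 1) ^ 4) (q.1 + q.2 * 2 ^ j ^ 4)) ≤ k with hP
  have h1 : W.card * 2 ^ d ≤ P.card := by
    rw [hP, Finset.card_filter, Finset.sum_product, ← smul_eq_mul]
    refine Finset.card_nsmul_le_sum _ _ _ fun w hw => ?_
    obtain ⟨A, hA, hcard, hK⟩ := hW w hw
    rw [← Finset.card_filter]
    refine hcard.trans (Finset.card_le_card fun a ha => ?_)
    exact Finset.mem_filter.2 ⟨hA ha, hK a ha⟩
  refine h1.trans_lt ?_
  rw [← Finset.card_image_of_injOn (s := P)
    (f := fun q => toStr ((j + 1) ^ 4) (q.1 + q.2 * 2 ^ j ^ 4))]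
  · refine hU.card_lt fun w hw => ?_
    obtain ⟨q, hq, rfl⟩ := Finset.mem_image.1 hw
    exact (Finset.mem_filter.1 hq).2
  -- The low j^4 digits of the extended string recover w, the remaining ones a.
  · rintro ⟨w, a⟩ hq ⟨w', a'⟩ hq' h
    have hq := (Finset.mem_filter.1 hq).1
    have hq' := (Finset.mem_filter.1 hq').1
    rw [Finset.mem_product, Finset.mem_range] at hq hq'
    have hw := hlt _ hq.1
    have hw' := hlt _ hq'.1
    simp only at hw hw' hq hq' h
    have heq := toStr_injOn (extension_lt hw hq.2) (extension_lt hw' hq'.2) h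
    have e1 : w = w' := by
      have := congrArg (· % 2 ^ j ^ 4) heq
      simpa [Nat.add_mul_mod_self_right, Nat.mod_eq_of_lt hw, Nat.mod_eq_of_lt hw'] using this
    subst e1
    have e2 : a = a' := Nat.eq_of_mul_eq_mul_right (by positivity) (Nat.add_left_cancel heq)
    rw [e2]

/-- A string with many simple extensions is simple. -/
theorem IsUniversal.exists_K_le_of_le_stageDeg (hU : IsUniversal U) {c : Code}
    (hc : ∀ p w : Str, w ∈ U p ↔ ∃ t, Code.evaln t c (encode p) = some (encode w)) :
    ∃ C : ℕ, ∀ {j k d w t l : ℕ}, j < 2 ^ l → k < 2 ^ l → d < 2 ^ l → w < 2 ^ j ^ 4 →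
      2 ^ d ≤ stageDeg c t k j w → K U (toStr (j ^ 4) w) + d ≤ k + 8 * l + C := by
  classical
  obtain ⟨C, hC⟩ := hU.exists_K_enum_le (R := fun p w t => ltTest w (2 ^ p.unpair.1 ^ 4) &&
      leTest (2 ^ p.unpair.2.unpair.2) (stageDeg c t p.unpair.2.unpair.1 p.unpair.1 w))
    (out := fun p w => toStr (p.unpair.1 ^ 4) w) (by fun_prop) (by fun_prop)
  refine ⟨C + 1, fun {j k d w t l} hj hk hd hw ht => ?_⟩
  have hle : 2 ^ l ≤ 2 ^ (2 * l) := Nat.pow_le_pow_right two_pos (by omega)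
  -- Two nested pairings quadruple the bit length, and the self-delimiting description doubles it:
  -- hence 8l.
  have hp : Nat.pair j (Nat.pair k d) < 2 ^ (2 * (2 * l)) :=
    natPair_lt_two_pow (hj.trans_le hle) (natPair_lt_two_pow hk hd)
  have := hC (Nat.pair j (Nat.pair k d)) w t _ (k + 1) d
    ((Finset.range (2 ^ j ^ 4)).filter fun w => ∃ t, 2 ^ d ≤ stageDeg c t k j w) hp
    (fun w t h => by simpa using ⟨(by simpa using h : _ ∧ _).1, t, (by simpa using h : _ ∧ _).2⟩)
    (by simpa using ⟨hw, ht⟩)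
    (by
      refine hU.card_mul_two_pow_lt (fun w hw => Finset.mem_range.1 (Finset.mem_filter.1 hw).1)
        fun w hw => ?_
      obtain ⟨t, ht⟩ := (Finset.mem_filter.1 hw).2
      rw [stageDeg_eq_card] at ht
      exact ⟨_, Finset.filter_subset _ _, ht, fun a ha =>
        (hU.exists_approx_iff hc).1 ⟨t, (Finset.mem_filter.1 ha).2⟩⟩)
  simp only [Nat.unpair_pair] at this
  omega

/-- If the value of the `j`-th block is confined to a small set depending on the previous
source segments, then there are few pairs of source segments. -/
theorem card_le_of_block_mem {Q j d : ℕ} {S T : Finset ℕ}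
    (hS : S ⊆ Finset.range (2 ^ srcLen Q (j + 1))) (hT : T ⊆ Finset.range (2 ^ srcLen Q (j + 1)))
    {W : Finset (ℕ × ℕ)} (hW : W ⊆ S ×ˢ T)
    (hA : ∀ u₀ v₀, ∃ A ⊆ Finset.range (2 ^ outLen j), A.card ≤ 2 ^ d ∧
      ∀ q ∈ W, q.1 % 2 ^ srcLen Q j = u₀ → q.2 % 2 ^ srcLen Q j = v₀ → block Q j q.1 q.2 ∈ A) :
    2 ^ outLen j * W.card
      ≤ 3 * 2 ^ d * ((S.card + 2 ^ (4 * srcLen Q j)) * (T.card + 2 ^ (4 * srcLen Q j))) := by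
  classical
  set N := 2 ^ srcLen Q j with hN
  set s := 2 ^ (3 * srcLen Q j) with hs
  have hNs : 2 ^ (4 * srcLen Q j) = N * s := by rw [hN, hs, ← pow_add]; ring_nf
  have hNpos : 0 < N := by positivity
  -- The bound for one pair of prefixes is a product, so the double sum over prefixes factors; the
  -- slack s is paid N times on each side, which gives 2^(4 n_j).
  have hfib : ∀ S : Finset ℕ, ∑ u₀ ∈ Finset.range N, ((S.filter fun u => u % N = u₀).card + s)
      = S.card + N * s := by
    intro S
    rw [Finset.sum_add_distrib, ← Finset.card_eq_sum_card_fiberwise]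
    · simp
    · intro u _
      exact Finset.mem_coe.2 (Finset.mem_range.2 (Nat.mod_lt _ hNpos))
  rw [Finset.card_eq_sum_card_fiberwise (f := fun q : ℕ × ℕ => (q.1 % N, q.2 % N))
    (t := Finset.range N ×ˢ Finset.range N), Finset.sum_product, hNs, ← hfib S, ← hfib T,
    Finset.sum_mul_sum, Finset.mul_sum, Finset.mul_sum]
  · refine Finset.sum_le_sum fun u₀ _ => ?_
    rw [Finset.mul_sum, Finset.mul_sum]
    refine Finset.sum_le_sum fun v₀ _ => ?_
    obtain ⟨A, hAsub, hAcard, hAmem⟩ := hA u₀ v₀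
    have hsub : (W.filter fun q => (q.1 % N, q.2 % N) = (u₀, v₀)) ⊆ A.biUnion fun a =>
        ((S.filter fun u => u % N = u₀) ×ˢ (T.filter fun v => v % N = v₀)).filter
          fun q => block Q j q.1 q.2 = a := by
      intro q hq
      obtain ⟨hqW, hq⟩ := Finset.mem_filter.1 hq
      rw [Prod.mk.injEq] at hq
      have hST := Finset.mem_product.1 (hW hqW)
      rw [Finset.mem_biUnion]
      refine ⟨_, hAmem q hqW hq.1 hq.2, ?_⟩
      simp only [Finset.mem_filter, Finset.mem_product]
      exact ⟨⟨⟨hST.1, hq.1⟩, hST.2, hq.2⟩, trivial⟩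
    calc 2 ^ outLen j * (W.filter fun q => (q.1 % N, q.2 % N) = (u₀, v₀)).card
        ≤ 2 ^ outLen j * ∑ a ∈ A,
          (((S.filter fun u => u % N = u₀) ×ˢ (T.filter fun v => v % N = v₀)).filter
            fun q => block Q j q.1 q.2 = a).card :=
          Nat.mul_le_mul_left _ ((Finset.card_le_card hsub).trans Finset.card_biUnion_le)
      _ ≤ ∑ a ∈ A, 3 * (((S.filter fun u => u % N = u₀).card + s)
            * ((T.filter fun v => v % N = v₀).card + s)) := by
          rw [Finset.mul_sum]
          refine Finset.sum_le_sum fun a ha => ?_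
          exact card_block_eq_le ((Finset.filter_subset _ _).trans hS)
            ((Finset.filter_subset _ _).trans hT) (Finset.mem_range.1 (hAsub ha))
      _ ≤ 2 ^ d * (3 * (((S.filter fun u => u % N = u₀).card + s)
            * ((T.filter fun v => v % N = v₀).card + s))) := by
          rw [Finset.sum_const, smul_eq_mul]
          exact Nat.mul_le_mul_right _ hAcard
      _ = _ := by ring
  · intro q _
    refine Finset.mem_coe.2 (Finset.mem_product.2 ⟨?_, ?_⟩) <;>
      exact Finset.mem_range.2 (Nat.mod_lt _ hNpos)

/-- By stage `t`, the source segments `u` and `v` and the first `j + 1` blocks of the output are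
found to be simple, while few extensions of the first `j` blocks are. -/
def isSuspect (c : Code) (Q j k d k₁ k₂ u v t : ℕ) : Bool :=
  ltTest u (2 ^ srcLen Q (j + 1)) && ltTest v (2 ^ srcLen Q (j + 1)) &&
  approx c t k₁ (toStr (srcLen Q (j + 1)) u) && approx c t k₂ (toStr (srcLen Q (j + 1)) v) &&
  approx c t k (toStr ((j + 1) ^ 4) (blocks Q (j + 1) u v)) &&
  ltTest (stageDeg c t k j (blocks Q j u v)) (2 ^ d)

@[fun_prop] theorem computable_isSuspect {α : Type*} [Primcodable α] (c : Code)
    {f₀ f₁ f₂ f₃ f₄ f₅ f₆ f₇ f₈ : α → ℕ} (h₀ : Computable f₀) (h₁ : Computable f₁)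
    (h₂ : Computable f₂) (h₃ : Computable f₃) (h₄ : Computable f₄) (h₅ : Computable f₅)
    (h₆ : Computable f₆) (h₇ : Computable f₇) (h₈ : Computable f₈) :
    Computable fun a => isSuspect c (f₀ a) (f₁ a) (f₂ a) (f₃ a) (f₄ a) (f₅ a) (f₆ a) (f₇ a)
      (f₈ a) := by
  unfold isSuspect; fun_prop

/-- That few extensions are simple is not an enumerable property, so it is tested only at the stage
at which the pair is found. Among the pairs over given prefixes the one with the latest such stage
decides: its short list of extensions already contains the blocks of all the others. -/
theorem IsUniversal.card_suspect_lt (hU : IsUniversal U) {c : Code}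
    (hc : ∀ p w : Str, w ∈ U p ↔ ∃ t, Code.evaln t c (encode p) = some (encode w))
    {Q j k d k₁ k₂ : ℕ} (hk₁ : 4 * srcLen Q j ≤ k₁) (hk₂ : 4 * srcLen Q j ≤ k₂)
    {W : Finset (ℕ × ℕ)} (hW : ∀ q ∈ W, ∃ t, isSuspect c Q j k d k₁ k₂ q.1 q.2 t = true) :
    W.card * 2 ^ outLen j < 2 ^ (d + k₁ + k₂ + 5) := by
  classical
  set n := srcLen Q (j + 1) with hn
  choose! t ht using hW
  simp only [isSuspect, Bool.and_eq_true, ltTest_eq_true, and_assoc, ← hn] at ht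
  set S : ℕ → Finset ℕ := fun k => (Finset.range (2 ^ n)).filter fun u => K U (toStr n u) ≤ k
    with hS
  have hScard : ∀ k, (S k).card < 2 ^ (k + 1) := fun k => by
    rw [← Finset.card_image_of_injOn (s := S k) (f := toStr n)]
    · refine hU.card_lt fun w hw => ?_
      obtain ⟨u, hu, rfl⟩ := Finset.mem_image.1 hw
      exact (Finset.mem_filter.1 hu).2
    · intro u hu v hv h
      exact toStr_injOn (Finset.mem_range.1 (Finset.mem_filter.1 hu).1)
        (Finset.mem_range.1 (Finset.mem_filter.1 hv).1) h
  have hWsub : W ⊆ S k₁ ×ˢ S k₂ := by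
    intro q hq
    obtain ⟨h1, h2, h3, h4, -⟩ := ht q hq
    simp only [hS, Finset.mem_product, Finset.mem_filter, Finset.mem_range]
    exact ⟨⟨h1, (hU.exists_approx_iff hc).1 ⟨_, h3⟩⟩, h2, (hU.exists_approx_iff hc).1 ⟨_, h4⟩⟩
  have hmain := card_le_of_block_mem (Q := Q) (j := j) (d := d) (S := S k₁) (T := S k₂)
    (Finset.filter_subset _ _) (Finset.filter_subset _ _) hWsub (by
      intro u₀ v₀
      set F := W.filter fun q => q.1 % 2 ^ srcLen Q j = u₀ ∧ q.2 % 2 ^ srcLen Q j = v₀ with hF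
      rcases F.eq_empty_or_nonempty with hFe | hFne
      · refine ⟨∅, by simp, by simp, fun q hq h1 h2 => ?_⟩
        have : q ∈ F := Finset.mem_filter.2 ⟨hq, h1, h2⟩
        rw [hFe] at this
        simp at this
      · obtain ⟨q₀, hq₀, hmax⟩ := F.exists_max_image t hFne
        obtain ⟨hq₀W, hu₀, hv₀⟩ := Finset.mem_filter.1 hq₀
        refine ⟨(Finset.range (2 ^ outLen j)).filter fun a => approx c (t q₀) k
          (toStr ((j + 1) ^ 4) (blocks Q j q₀.1 q₀.2 + a * 2 ^ j ^ 4)) = true,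
          Finset.filter_subset _ _, ?_, fun q hq h1 h2 => ?_⟩
        · rw [← stageDeg_eq_card]
          exact (ht q₀ hq₀W).2.2.2.2.2.le
        · refine Finset.mem_filter.2 ⟨Finset.mem_range.2 (block_lt _ _ _ _), ?_⟩
          rw [blocks_congr (le_refl (srcLen Q j)) (hu₀.trans h1.symm) (hv₀.trans h2.symm),
            ← blocks_succ]
          exact approx_mono (hmax q (Finset.mem_filter.2 ⟨hq, h1, h2⟩)) (ht q hq).2.2.2.2.1)
  have hle : ∀ {k}, 4 * srcLen Q j ≤ k → (S k).card + 2 ^ (4 * srcLen Q j) ≤ 3 * 2 ^ k := by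
    intro k hk
    have h1 := (hScard k).le
    have h2 : 2 ^ (4 * srcLen Q j) ≤ 2 ^ k := Nat.pow_le_pow_right two_pos hk
    rw [pow_succ] at h1
    omega
  calc W.card * 2 ^ outLen j
      ≤ 3 * 2 ^ d * ((3 * 2 ^ k₁) * (3 * 2 ^ k₂)) := by
        rw [mul_comm]
        exact hmain.trans (Nat.mul_le_mul_left _ (Nat.mul_le_mul (hle hk₁) (hle hk₂)))
    -- 27 < 2^5 explains the 5 in the exponent.
    _ = 27 * 2 ^ (d + k₁ + k₂) := by rw [pow_add, pow_add]; ring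
    _ < 2 ^ (d + k₁ + k₂ + 5) := by
        rw [pow_add _ _ 5]
        have : 0 < 2 ^ (d + k₁ + k₂) := by positivity
        omega

/-- If the next block has a simple value among few, then the pair of sources is simple. -/
theorem IsUniversal.exists_K_append_le (hU : IsUniversal U) {c : Code}
    (hc : ∀ p w : Str, w ∈ U p ↔ ∃ t, Code.evaln t c (encode p) = some (encode w)) (Q : ℕ) :
    ∃ C : ℕ, ∀ {j k d k₁ k₂ u v l : ℕ}, j < 2 ^ l → k < 2 ^ l → d < 2 ^ l → k₁ < 2 ^ l →
      k₂ < 2 ^ l → 4 * srcLen Q j ≤ k₁ → 4 * srcLen Q j ≤ k₂ →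
      u < 2 ^ srcLen Q (j + 1) → v < 2 ^ srcLen Q (j + 1) →
      K U (toStr (srcLen Q (j + 1)) u) ≤ k₁ → K U (toStr (srcLen Q (j + 1)) v) ≤ k₂ →
      K U (toStr ((j + 1) ^ 4) (blocks Q (j + 1) u v)) ≤ k →
      (∀ t, stageDeg c t k j (blocks Q j u v) < 2 ^ d) →
      K U (toStr (srcLen Q (j + 1)) u ++ toStr (srcLen Q (j + 1)) v) + outLen j
        ≤ d + k₁ + k₂ + 16 * l + C := by
  classical
  obtain ⟨C, hC⟩ := hU.exists_K_enum_le
    (R := fun p w t => isSuspect c Q p.unpair.1.unpair.1 p.unpair.1.unpair.2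
      p.unpair.2.unpair.1.unpair.1 p.unpair.2.unpair.1.unpair.2 p.unpair.2.unpair.2
      w.unpair.1 w.unpair.2 t)
    (out := fun p w => toStr (srcLen Q (p.unpair.1.unpair.1 + 1)) w.unpair.1
      ++ toStr (srcLen Q (p.unpair.1.unpair.1 + 1)) w.unpair.2) (by fun_prop) (by fun_prop)
  refine ⟨C + 5, fun {j k d k₁ k₂ u v l} hj hk hd hl₁ hl₂ hk₁ hk₂ hu hv hKu hKv hK hdeg => ?_⟩
  have hle : 2 ^ l ≤ 2 ^ (2 * l) := Nat.pow_le_pow_right two_pos (by omega)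
  have hle' : 2 ^ (2 * l) ≤ 2 ^ (2 * (2 * l)) := Nat.pow_le_pow_right two_pos (by omega)
  -- Three levels of pairing give 8l bits, doubled to 16l in the description.
  have hp : Nat.pair (Nat.pair j k) (Nat.pair (Nat.pair d k₁) k₂) < 2 ^ (2 * (2 * (2 * l))) :=
    natPair_lt_two_pow ((natPair_lt_two_pow hj hk).trans_le hle')
      (natPair_lt_two_pow (natPair_lt_two_pow hd hl₁) (hl₂.trans_le hle))
  obtain ⟨t₁, ht₁⟩ := (hU.exists_approx_iff hc).2 hKu
  obtain ⟨t₂, ht₂⟩ := (hU.exists_approx_iff hc).2 hKv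
  obtain ⟨t₃, ht₃⟩ := (hU.exists_approx_iff hc).2 hK
  have hsus : isSuspect c Q j k d k₁ k₂ u v (max t₁ (max t₂ t₃)) = true := by
    simp only [isSuspect, Bool.and_eq_true, ltTest_eq_true]
    exact ⟨⟨⟨⟨⟨hu, hv⟩, approx_mono (le_max_left _ _) ht₁⟩,
      approx_mono ((le_max_left _ _).trans (le_max_right _ _)) ht₂⟩,
      approx_mono ((le_max_right _ _).trans (le_max_right _ _)) ht₃⟩, hdeg _⟩
  set W := (Finset.range (2 ^ srcLen Q (j + 1)) ×ˢ Finset.range (2 ^ srcLen Q (j + 1))).filter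
    fun q => ∃ t, isSuspect c Q j k d k₁ k₂ q.1 q.2 t = true with hW
  have := hC (Nat.pair (Nat.pair j k) (Nat.pair (Nat.pair d k₁) k₂)) (Nat.pair u v)
    (max t₁ (max t₂ t₃)) _ (d + k₁ + k₂ + 5) (outLen j) (W.image fun q => Nat.pair q.1 q.2) hp
    (fun w t h => by
      simp only [Nat.unpair_pair] at h
      refine Finset.mem_image.2 ⟨w.unpair, Finset.mem_filter.2 ⟨?_, t, h⟩, Nat.pair_unpair w⟩
      simp only [isSuspect, Bool.and_eq_true, ltTest_eq_true] at h
      exact Finset.mem_product.2 ⟨Finset.mem_range.2 h.1.1.1.1.1, Finset.mem_range.2 h.1.1.1.1.2⟩)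
    (by simpa only [Nat.unpair_pair] using hsus)
    ((Nat.mul_le_mul_right _ Finset.card_image_le).trans_lt
      (hU.card_suspect_lt hc hk₁ hk₂ fun q hq => (Finset.mem_filter.1 hq).2))
  simp only [Nat.unpair_pair] at this
  omega

open Filter

/-! ### The randomness rate of the output -/

/-- Blocks grow faster than linearly in j, so they outweigh the O(j) overhead per block. -/
theorem sq_le_outLen (j : ℕ) : (j + 1) ^ 2 ≤ outLen j := by
  have := pow_add_outLen j
  nlinarith [sq_nonneg j]

theorem srcLen_le_two_pow {Q B : ℕ} (hB : ratio Q ≤ B) (j : ℕ) :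
    srcLen Q j ≤ 2 ^ (B * (j + 1)) := by
  rw [srcLen, pow_mul]
  exact Nat.pow_le_pow_left (hB.trans Nat.lt_two_pow_self.le) _

theorem lt_srcLen (Q j : ℕ) : j < srcLen Q j := by
  have := pow_four_le_srcLen Q j
  have h1 : j + 1 ≤ (j + 1) ^ 4 := Nat.le_self_pow (by norm_num) _
  omega

/-- The left side collects the bits for the parameters (l = B(j + 2) + 1), the constant C, and the
loss R(2 log n + 1) allowed by independence, with log n ≤ B(j + 2). -/
theorem overhead_lt (B C R j : ℕ) : 16 * (B * (j + 2) + 1) + C + R * (2 * (B * (j + 2)) + 1)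
    < (32 * B + 16 + C + R * (4 * B + 1) + 1) * (j + 1) := by
  have e1 : 16 * (B * (j + 2) + 1) ≤ (32 * B + 16) * (j + 1) := by nlinarith
  have e2 : C ≤ C * (j + 1) := Nat.le_mul_of_pos_right _ (by omega)
  have e3 : R * (2 * (B * (j + 2)) + 1) ≤ R * ((4 * B + 1) * (j + 1)) :=
    Nat.mul_le_mul_left _ (by nlinarith)
  have e4 : (32 * B + 16 + C + R * (4 * B + 1) + 1) * (j + 1)
    = (32 * B + 16) * (j + 1) + C * (j + 1) + R * ((4 * B + 1) * (j + 1)) + (j + 1) := by ring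
  omega

/-- A sequence of positive randomness rate has source segments whose complexity is large compared
with the length of the previous ones. -/
theorem HasRandomnessRate.eventually_srcLen_le {τ : ℚ} (hτ : 0 < τ) {x : BinSeq}
    (hx : HasRandomnessRate U τ x) :
    ∀ᶠ j in atTop, 4 * srcLen τ.den j ≤ K U (x.initSeg (srcLen τ.den (j + 1))) := by
  have htend : Tendsto (fun j => srcLen τ.den (j + 1)) atTop atTop :=
    tendsto_atTop_mono (fun j => (Nat.le_succ j).trans (lt_srcLen τ.den (j + 1)).le) tendsto_id
  filter_upwards [htend.eventually hx] with j hj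
  -- The product is the numerator of τ. Hence τ ≥ 1 / `τ.den`, and the denominator alone can fix the
  -- ratio.
  have h1 : (1 : ℝ) ≤ τ * τ.den := by
    have h2 : (τ : ℝ) * τ.den = τ.num := by exact_mod_cast Rat.mul_den_eq_num τ
    rw [h2]
    exact_mod_cast Rat.num_pos.2 hτ
  have hτ' : (0 : ℝ) ≤ τ := by exact_mod_cast hτ.le
  rw [srcLen_succ τ.den j] at hj
  have h3 : (4 * srcLen τ.den j : ℝ) ≤ τ * (ratio τ.den * srcLen τ.den j : ℕ) := by
    rw [ratio]
    push_cast
    have h4 : (0 : ℝ) ≤ srcLen τ.den j := Nat.cast_nonneg _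
    have h5 : (4 : ℝ) ≤ τ * (16 * (τ.den + 1)) := by nlinarith
    nlinarith [mul_le_mul_of_nonneg_right h5 h4]
  rw [srcLen_succ τ.den j]
  exact_mod_cast h3.trans hj

/-- Almost all bits of every new block of the output count. -/
theorem IsUniversal.exists_K_extract_succ (hU : IsUniversal U) {τ : ℚ} (hτ : 0 < τ)
    {x y : BinSeq} (hxy : Independent U x y) (hx : HasRandomnessRate U τ x)
    (hy : HasRandomnessRate U τ y) :
    ∃ C : ℕ, ∀ᶠ j in atTop, K U ((extract τ x y).initSeg (j ^ 4)) + outLen j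
      ≤ K U ((extract τ x y).initSeg ((j + 1) ^ 4)) + C * (j + 1) := by
  obtain ⟨c, hc⟩ := exists_code hU.partrec
  obtain ⟨C₀, hC₀⟩ := hU.exists_K_le_length
  obtain ⟨C₁, hC₁⟩ := hU.exists_K_le_of_le_stageDeg hc
  obtain ⟨C₂, hC₂⟩ := hU.exists_K_append_le hc τ.den
  obtain ⟨r, hr⟩ := hxy
  obtain ⟨R, hR⟩ := exists_nat_ge r
  set Q := τ.den with hQ
  set B := ratio Q + C₀ with hB
  set D₀ := 32 * B + 16 + C₂ + R * (4 * B + 1) + 1 with hD₀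
  refine ⟨D₀ + 16 * B + 8 + C₁, ?_⟩
  filter_upwards [hx.eventually_srcLen_le hτ, hy.eventually_srcLen_le hτ, eventually_ge_atTop D₀]
    with j hxj hyj hj
  rw [← hQ] at hxj hyj
  set n := srcLen Q (j + 1) with hn
  -- This bit length accommodates every number used as a parameter: all are at most n + C₀, and n
  -- and C₀ are both bounded through `B`.
  set l := B * (j + 2) + 1 with hl
  have hnB : n ≤ 2 ^ (B * (j + 2)) := srcLen_le_two_pow (Nat.le_add_right _ _) (j + 1)
  have hlt : n + C₀ < 2 ^ l := by
    have h1 : C₀ < 2 ^ (B * (j + 2)) := by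
      refine lt_of_lt_of_le Nat.lt_two_pow_self (Nat.pow_le_pow_right two_pos ?_)
      nlinarith
    rw [hl, pow_succ]
    omega
  have hjn : (j + 1) ^ 4 ≤ n :=
    (Nat.pow_le_pow_left (by omega) 4).trans (pow_four_le_srcLen Q (j + 1))
  have hjn' : j + 1 < n := lt_srcLen Q (j + 1)
  have hout := pow_add_outLen j
  have hD : D₀ * (j + 1) ≤ outLen j := by
    have := sq_le_outLen j
    nlinarith
  -- The threshold 2^d falls short of the number of all block values by the factor 2^(D₀(j+1)),
  -- which must exceed the overhead in the second case and is lost in the first.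
  obtain ⟨d, hd⟩ := Nat.exists_eq_add_of_le hD
  have hu := x.prefixNum_lt n
  have hv := y.prefixNum_lt n
  have hxs := x.toStr_prefixNum n
  have hys := y.toStr_prefixNum n
  have hz : toStr (j ^ 4) (blocks Q j (x.prefixNum n) (y.prefixNum n))
      = (extract τ x y).initSeg (j ^ 4) :=
    initSeg_extract τ x y (srcLen_mono _ (Nat.le_succ j))
  have hz' : toStr ((j + 1) ^ 4) (blocks Q (j + 1) (x.prefixNum n) (y.prefixNum n))
      = (extract τ x y).initSeg ((j + 1) ^ 4) := initSeg_extract τ x y le_rfl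
  have hkx := hC₀ (x.initSeg n)
  have hky := hC₀ (y.initSeg n)
  have hkz := hC₀ ((extract τ x y).initSeg ((j + 1) ^ 4))
  rw [BinSeq.length_initSeg] at hkx hky hkz
  by_cases hdeg : ∃ t, 2 ^ d ≤ stageDeg c t (K U ((extract τ x y).initSeg ((j + 1) ^ 4))) j
      (blocks Q j (x.prefixNum n) (y.prefixNum n))
  · obtain ⟨t, ht⟩ := hdeg
    have := hC₁ (l := l) (by omega) (by omega) (by omega) (blocks_lt _ _ _ _) ht
    rw [hz] at this
    have h2 : 8 * l + C₁ ≤ (16 * B + 8 + C₁) * (j + 1) := by rw [hl]; nlinarith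
    have h3 : (D₀ + 16 * B + 8 + C₁) * (j + 1) = D₀ * (j + 1) + (16 * B + 8 + C₁) * (j + 1) := by
      ring
    omega
  · exfalso
    push Not at hdeg
    have h1 := hC₂ (l := l) (by omega) (by omega) (by omega) (by omega) (by omega) hxj hyj hu hv
      (by rw [← hn, hxs]) (by rw [← hn, hys]) (by rw [hz']) hdeg
    rw [← hn, hxs, hys] at h1
    have h2 := hr n n
    have hlog : Real.logb 2 n ≤ B * (j + 2) := by
      have hn0 : (0 : ℝ) < n := by exact_mod_cast (by omega : 0 < n)
      rw [Real.logb_le_iff_le_rpow one_lt_two hn0]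
      have : (n : ℝ) ≤ ((2 ^ (B * (j + 2)) : ℕ) : ℝ) := by exact_mod_cast hnB
      refine this.trans (le_of_eq ?_)
      rw [Nat.cast_pow, ← Real.rpow_natCast]
      push_cast
      rfl
    have hlog0 : 0 ≤ Real.logb 2 n :=
      Real.logb_nonneg one_lt_two (by exact_mod_cast (by omega : 1 ≤ n))
    have h3 : r * (Real.logb 2 n + Real.logb 2 n + 1) ≤ R * (2 * (B * (j + 2)) + 1) := by
      refine mul_le_mul hR (by linarith) (by linarith) (Nat.cast_nonneg _)
    have h4 : (K U (x.initSeg n) : ℝ) + K U (y.initSeg n)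
        ≤ K U (x.initSeg n ++ y.initSeg n) + R * (2 * (B * (j + 2)) + 1) := by linarith
    have h5 : K U (x.initSeg n) + K U (y.initSeg n)
        ≤ K U (x.initSeg n ++ y.initSeg n) + R * (2 * (B * (j + 2)) + 1) := by exact_mod_cast h4
    have h6 : 16 * l + C₂ + R * (2 * (B * (j + 2)) + 1) < D₀ * (j + 1) :=
      overhead_lt B C₂ R j
    omega

/-- The losses C(j + 1) add up to C j^2; the blocks before the threshold j₀ are written off by a
constant. -/
theorem IsUniversal.exists_pow_le_K_extract (hU : IsUniversal U) {τ : ℚ} (hτ : 0 < τ)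
    {x y : BinSeq} (hxy : Independent U x y) (hx : HasRandomnessRate U τ x)
    (hy : HasRandomnessRate U τ y) :
    ∃ C : ℕ, ∀ᶠ j in atTop, j ^ 4 ≤ K U ((extract τ x y).initSeg (j ^ 4)) + C * j ^ 2 + C := by
  obtain ⟨C, hC⟩ := hU.exists_K_extract_succ hτ hxy hx hy
  obtain ⟨j₀, hj₀⟩ := eventually_atTop.1 hC
  refine ⟨C + j₀ ^ 4, eventually_atTop.2 ⟨j₀, fun j hj => ?_⟩⟩
  suffices h : j ^ 4 ≤ K U ((extract τ x y).initSeg (j ^ 4)) + C * j ^ 2 + j₀ ^ 4 by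
    have : 0 ≤ j₀ ^ 4 * j ^ 2 := Nat.zero_le _
    rw [add_mul]
    omega
  induction j, hj using Nat.le_induction with
  | base => omega
  | succ j hj ih =>
    have h1 := hj₀ j hj
    have h2 := pow_add_outLen j
    have h3 : C * (j + 1) + C * j ^ 2 ≤ C * (j + 1) ^ 2 := by
      rw [← mul_add]
      exact Nat.mul_le_mul_left _ (by nlinarith)
    omega

theorem IsUniversal.hasRandomnessRate_extract (hU : IsUniversal U) {τ : ℚ} (hτ : 0 < τ)
    {x y : BinSeq} (hxy : Independent U x y) (hx : HasRandomnessRate U τ x)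
    (hy : HasRandomnessRate U τ y) {δ : ℝ} (hδ : 0 < δ) :
    HasRandomnessRate U (1 - δ) (extract τ x y) := by
  obtain ⟨C, hC⟩ := hU.exists_pow_le_K_extract hτ hxy hx hy
  obtain ⟨C', hC'⟩ := hU.exists_K_map_le
    (g := fun w : Str => w.take (w.length.sqrt.sqrt ^ 4)) (by fun_prop)
  -- From (j + 1)^4 ≤ j^4 + 15 j^3 come 15, from the loss at j^4 come 2C, and from truncating the
  -- segment comes C'; beyond j₁, δ j^4 absorbs this multiple of j^3.
  obtain ⟨j₁, hj₁⟩ := exists_nat_ge ((15 + 2 * C + C') / δ)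
  have htend : Tendsto (fun n : ℕ => n.sqrt.sqrt) atTop atTop :=
    tendsto_atTop.2 fun j => eventually_atTop.2 ⟨j ^ 4, fun n hn => le_sqrt_sqrt.2 hn⟩
  refine (htend.eventually (hC.and (eventually_ge_atTop (max j₁ 1)))).mono fun n hn => ?_
  obtain ⟨h1, h2⟩ := hn
  set z := extract τ x y with hz
  set j := n.sqrt.sqrt with hj
  have hjn : j ^ 4 ≤ n := le_sqrt_sqrt.1 le_rfl
  have hnj : n < (j + 1) ^ 4 := by
    rw [← not_le, ← le_sqrt_sqrt, ← hj]; omega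
  have htake : (z.initSeg n).take (j ^ 4) = z.initSeg (j ^ 4) := by
    refine List.ext_getElem (by simp [hjn]) fun i h1 h2 => ?_
    simp [BinSeq.initSeg]
  have h3 := hC' (z.initSeg n)
  simp only [BinSeq.length_initSeg, ← hj, htake] at h3
  rcases le_or_gt (1 - δ) 0 with h0 | h0
  · exact (mul_nonpos_of_nonpos_of_nonneg h0 (Nat.cast_nonneg _)).trans (Nat.cast_nonneg _)
  have hj1 : (1 : ℝ) ≤ j := by exact_mod_cast (le_max_right _ _).trans h2
  have hjj₁ : (15 + 2 * C + C') ≤ δ * j := by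
    have : (j₁ : ℝ) ≤ j := by exact_mod_cast (le_max_left _ _).trans h2
    have := hj₁.trans this
    rwa [div_le_iff₀ hδ, mul_comm (j : ℝ)] at this
  have h4 : (j : ℝ) ^ 4 ≤ K U (z.initSeg n) + C' + C * j ^ 2 + C := by
    have : j ^ 4 ≤ K U (z.initSeg n) + C' + C * j ^ 2 + C := by omega
    exact_mod_cast this
  have h5 : (n : ℝ) ≤ ((j : ℝ) + 1) ^ 4 := by exact_mod_cast hnj.le
  have hj2 : (1 : ℝ) ≤ j ^ 2 := one_le_pow₀ hj1
  have hj3 : (j : ℝ) ^ 2 ≤ j ^ 3 := pow_le_pow_right₀ hj1 (by norm_num)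
  have h6 : ((j : ℝ) + 1) ^ 4 ≤ j ^ 4 + 15 * j ^ 3 := by nlinarith
  have h7 : (15 + 2 * C + C' : ℝ) * j ^ 3 ≤ δ * j ^ 4 := by
    calc (15 + 2 * C + C' : ℝ) * j ^ 3 ≤ (δ * j) * j ^ 3 := by gcongr
      _ = δ * j ^ 4 := by ring
  have h8 : (1 - δ) * n ≤ (1 - δ) * (j ^ 4 + 15 * j ^ 3) :=
    mul_le_mul_of_nonneg_left (h5.trans h6) h0.le
  have h9 : 0 ≤ δ * (15 * (j : ℝ) ^ 3) := by positivity
  have h10 : (C : ℝ) * j ^ 2 ≤ C * j ^ 3 := by gcongr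
  have h11 : (C : ℝ) ≤ C * j ^ 3 := le_mul_of_one_le_right (Nat.cast_nonneg _) (hj2.trans hj3)
  have h12 : (C' : ℝ) ≤ C' * j ^ 3 := le_mul_of_one_le_right (Nat.cast_nonneg _) (hj2.trans hj3)
  nlinarith

end RandExt

theorem theorem1 (U : RandExt.Str →. RandExt.Str) (hU : RandExt.IsUniversal U) :
    ∃ (f : ℚ → RandExt.BinSeq → RandExt.BinSeq → RandExt.BinSeq) (M : RandExt.OracleMachine),
      M.Represents f ∧ M.IsTruthTable ∧
      ∀ τ : ℚ, 0 < τ → τ ≤ 1 → ∀ x y : RandExt.BinSeq,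
        RandExt.Independent U x y →
        RandExt.HasRandomnessRate U τ x → RandExt.HasRandomnessRate U τ y →
        ∀ δ : ℝ, 0 < δ → RandExt.HasRandomnessRate U (1 - δ) (f τ x y) := by
  obtain ⟨M, hM⟩ := RandExt.exists_represents_extract
  exact ⟨RandExt.extract, M, hM, hM.isTruthTable, fun τ hτ _ x y hxy hx hy δ hδ =>
    hU.hasRandomnessRate_extract hτ hxy hx hy hδ⟩
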